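/- Let $\Gamma$ be a compact connected metric graph with finite vertex set $V$ and finite edge set $E$ (loops and multiple edges are allowed), each edge $e$ being identified with an interval $[0,L_e]$, $0<L_e<\infty$. Let $q:\Gamma\to\mathbb{R}$ be piecewise continuous, let $\chi_v\in\mathbb{R}\cup\{\infty\}$ for each vertex $v$, where $\chi_v=\infty$ is allowed only at vertices of degree one, and let $\beta=|E|-|V|+1$. Choose a spanning tree of $\Gamma$, enumerate the $\beta$ edges outside it, and choose an interior point $c_j$ on the $j$-th of them, $1\le j\le\beta$. Cutting $\Gamma$ at the points $c_j$ gives a metric tree $T$, in which $c_j$ is replaced by two vertices $c_j^-$, $c_j^+$ of degree one. For $\boldsymbol\alpha=(\alpha_1,\dots,\alpha_\beta)\in\mathbb{R}^\beta$ let $H^{\boldsymbol\alpha}$ be the operator $f\mapsto -f''+qf$ in $L^2(T,\mathbb{C})$ whose domain consists of the functions $f$ that lie in the Sobolev space $H^2$ on every edge of $T$ and satisfy * at every $v\in V$: $f$ is continuous at $v$ and $\sum_{e}\frac{df}{dx_e}(v)=\chi_v f(v)$ (read as $f(v)=0$ if $\chi_v=\infty$), the sum being over the edge ends at $v$; * at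 the new vertices: $f(c_j^+)=e^{i\alpha_j}f(c_j^-)$ and $f'(c_j^+)=-e^{i\alpha_j}f'(c_j^-)$ for $j=1,\dots,\beta$; all derivatives at vertices being taken into the edges. (Every magnetic Schrödinger operator on $\Gamma$ with potential $q$ and these vertex conditions is unitarily equivalent to some $H^{\boldsymbol\alpha}$.) Let $\sigma(\boldsymbol\alpha)\subset\mathbb{C}$ be the spectrum of $H^{\boldsymbol\alpha}$, and let $\lambda_1(\boldsymbol\alpha)\le\lambda_2(\boldsymbol\alpha)\le\cdots$ be its eigenvalues, in increasing order and repeated according to multiplicity. Let $$\Sigma=\{\pi(b_1,\dots,b_\beta): b_j\in\{0,1\}\}.$$ Then for every $\boldsymbol\varsigma\in\Sigma$ and every $\boldsymbol\alpha\in\mathbb{R}^\beta$, $$\sigma(\boldsymbol\varsigma-\boldsymbol\alpha)=\sigma(\boldsymbol\varsigma+\boldsymbol\alpha),$$ together with multiplicity: $\dim\ker(H^{\boldsymbol\varsigma-\boldsymbol\alpha}-z)=\dim\ker(H^{\boldsymbol\varsigma+\boldsymbol\alpha}-z)$ for every $z\in\mathbb{C}$. Consequently, if $n\ge1$ and the eigenvalue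 $\lambda_n(\boldsymbol\varsigma)$ of $H^{\boldsymbol\varsigma}$ is simple, then $\boldsymbol\varsigma$ is a critical point of the function $\boldsymbol\alpha\mapsto\lambda_n(\boldsymbol\alpha)$: this function is differentiable at $\boldsymbol\varsigma$, with derivative $0$. -/

import Mathlib

open MeasureTheory Set Filter Topology

noncomputable section

namespace QG

/-! ### Metric graphs, spanning trees -/

/-- A metric graph with vertex set `V` and edge set `E` (loops and multiple edges allowed): the edge
`e` is identified with `[0, length e]`; the point `0` is glued to the vertex `endpoint e false` and
the point `length e` to the vertex `endpoint e true`. It is compact when `V` and `E` are finite. -/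
structure MetricGraph (V E : Type*) where
  endpoint : E → Bool → V
  length : E → ℝ
  length_pos : ∀ e, 0 < length e

namespace MetricGraph

variable {V E : Type*} (G : MetricGraph V E)

/-- `u` and `v` are joined by a path that uses only edges of `S`. -/
def JoinedIn (S : Set E) : V → V → Prop :=
  Relation.EqvGen fun u v => ∃ e ∈ S, G.endpoint e false = u ∧ G.endpoint e true = v

def Connected : Prop := Nonempty V ∧ ∀ u v, G.JoinedIn Set.univ u v

/-- `S` is the edge set of a spanning tree: it connects all the vertices and contains no cycle, i.e.
the ends of an edge of `S` are not joined by the other edges of `S`. -/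
def IsSpanningTree (S : Set E) : Prop :=
  (∀ u v, G.JoinedIn S u v) ∧
    ∀ e ∈ S, ¬ G.JoinedIn (S \ {e}) (G.endpoint e false) (G.endpoint e true)

/-- The degree of a vertex (a loop counts twice). -/
def degree (v : V) : ℕ := {h : E × Bool | G.endpoint h.1 h.2 = v}.ncard

/-- The first Betti number `|E| - |V| + 1` (of a connected graph). -/
def betti [Fintype V] [Fintype E] (_ : MetricGraph V E) : ℕ :=
  Fintype.card E + 1 - Fintype.card V

end MetricGraph

/-- `q` is piecewise continuous on `[a, b]`: continuous outside a finite set, with finite one-sided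
limits everywhere. -/
def PiecewiseContinuousOn (q : ℝ → ℝ) (a b : ℝ) : Prop :=
  (∃ S : Set ℝ, S.Finite ∧ ContinuousOn q (Icc a b \ S)) ∧
  (∀ x ∈ Ico a b, ∃ l, Tendsto q (𝓝[>] x) (𝓝 l)) ∧
  (∀ x ∈ Ioc a b, ∃ l, Tendsto q (𝓝[<] x) (𝓝 l))

/-- The data of a Schrödinger operator with `δ`-type conditions on a connected metric graph: the
potential `q` and the coefficients `χ`, where `χ v = ⊤` is the Dirichlet condition, allowed at
vertices of degree one only. -/
structure QuantumGraph (V E : Type*) extends MetricGraph V E where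
  connected : toMetricGraph.Connected
  q : E → ℝ → ℝ
  q_pc : ∀ e, PiecewiseContinuousOn (q e) 0 (length e)
  χ : V → WithTop ℝ
  dirichlet_leaf : ∀ v, χ v = ⊤ → toMetricGraph.degree v = 1

/-! ### Cutting the cycles -/

/-- The complement of a spanning tree, enumerated as `edge 0, …, edge (β - 1)`, and an interior point
`pos j` of each of these edges. -/
structure Cut {V E : Type*} [Fintype V] [Fintype E] (G : MetricGraph V E) where
  edge : Fin G.betti → E
  edge_injective : Function.Injective edge
  spanning : G.IsSpanningTree (Set.range edge)ᶜ
  pos : Fin G.betti → ℝ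
  pos_mem : ∀ j, pos j ∈ Ioo 0 (G.length (edge j))

section Tree

variable {V E : Type*} [Fintype V] [Fintype E]

/-- The vertices of the cut tree `T`: those of the graph, and the new vertices
`c_j^- = Sum.inr (j, false)` and `c_j^+ = Sum.inr (j, true)`. -/
abbrev TreeVertex {G : MetricGraph V E} (_ : Cut G) : Type _ := V ⊕ (Fin G.betti × Bool)

/-- The edges of the cut tree `T`: the edges that are not cut, and for each `j` the two pieces of
the `j`-th cut edge: `Sum.inr (j, false)`, ending at `c_j^-`, and `Sum.inr (j, true)`, starting at
`c_j^+`. -/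
abbrev TreeEdge {G : MetricGraph V E} (c : Cut G) : Type _ :=
  {e : E // e ∉ Set.range c.edge} ⊕ (Fin G.betti × Bool)

instance {G : MetricGraph V E} (c : Cut G) : Fintype (TreeEdge c) := Fintype.ofFinite _

/-- The cut tree `T`. -/
def cutTree {G : MetricGraph V E} (c : Cut G) : MetricGraph (TreeVertex c) (TreeEdge c) where
  endpoint
    | Sum.inl e, b => Sum.inl (G.endpoint e.1 b)
    | Sum.inr (j, false), false => Sum.inl (G.endpoint (c.edge j) false)
    | Sum.inr (j, false), true => Sum.inr (j, false)
    | Sum.inr (j, true), false => Sum.inr (j, true)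
    | Sum.inr (j, true), true => Sum.inl (G.endpoint (c.edge j) true)
  length
    | Sum.inl e => G.length e.1
    | Sum.inr (j, false) => c.pos j
    | Sum.inr (j, true) => G.length (c.edge j) - c.pos j
  length_pos := by
    rintro (e | ⟨j, _ | _⟩)
    · exact G.length_pos _
    · exact (c.pos_mem j).1
    · exact sub_pos.2 (c.pos_mem j).2

/-- The potential, as a function on the cut tree. -/
def treePotential (Γ : QuantumGraph V E) (c : Cut Γ.toMetricGraph) : TreeEdge c → ℝ → ℝ
  | Sum.inl e => Γ.q e.1
  | Sum.inr (j, false) => Γ.q (c.edge j)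
  | Sum.inr (j, true) => fun x => Γ.q (c.edge j) (c.pos j + x)

end Tree

/-! ### Function spaces on a metric graph -/

/-- `L²(e)` for an edge of length `L`. -/
abbrev EdgeL2 (L : ℝ) : Type := Lp ℂ 2 (volume.restrict (Icc 0 L))

/-- The Hilbert space `⊕_e L²(e)`. -/
abbrev GraphL2 {V E : Type*} [Fintype E] (G : MetricGraph V E) : Type _ :=
  PiLp 2 fun e : E => EdgeL2 (G.length e)

/-- `f` lies in the Sobolev space `H²(0, L)`, with derivatives `f' = f₁` and `f'' = f₂`: `f` and `f₁`
are absolutely continuous on `[0, L]`, being the integrals of `f₁` and of `f₂ ∈ L²(0, L)`. -/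
structure IsSobolevTwo (L : ℝ) (f f₁ f₂ : ℝ → ℂ) : Prop where
  memLp : MemLp f₂ 2 (volume.restrict (Icc 0 L))
  snd : ∀ x ∈ Icc 0 L, f₁ x = f₁ 0 + ∫ t in (0 : ℝ)..x, f₂ t
  fst : ∀ x ∈ Icc 0 L, f x = f 0 + ∫ t in (0 : ℝ)..x, f₁ t

namespace MetricGraph

variable {V E : Type*} (G : MetricGraph V E)

/-- The value of a function on the graph at an end of an edge. -/
def endValue (f : E → ℝ → ℂ) (e : E) : Bool → ℂ
  | false => f e 0
  | true => f e (G.length e)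

/-- The derivative at an end of an edge, taken into the edge; `f₁` is the derivative with respect to
the coordinate on the edge. -/
def endDeriv (f₁ : E → ℝ → ℂ) (e : E) : Bool → ℂ
  | false => f₁ e 0
  | true => - f₁ e (G.length e)

open Classical in
/-- The `δ`-type condition at the vertex `v` with coefficient `χ` (Dirichlet if `χ = ⊤`):
`f` takes a common value `a` at all edge ends at `v`, and the derivatives into the edges add up to
`χ * a`. -/
def DeltaCondition [Fintype E] (f f₁ : E → ℝ → ℂ) (v : V) (χ : WithTop ℝ) : Prop :=
  ∃ a : ℂ, (∀ e b, G.endpoint e b = v → G.endValue f e b = a) ∧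
    (χ = ⊤ → a = 0) ∧
    ∀ r : ℝ, χ = (r : WithTop ℝ) →
      (∑ h : E × Bool, if G.endpoint h.1 h.2 = v then G.endDeriv f₁ h.1 h.2 else 0) = r * a

end MetricGraph

/-! ### The operator `H^α` on the cut tree -/

section Operator

variable {V E : Type*} [Fintype V] [Fintype E] (Γ : QuantumGraph V E) (c : Cut Γ.toMetricGraph)

/-- The vertex conditions of `H^α` for `f` with derivative `f₁`: those inherited from the graph at
the old vertices, and `f(c_j^+) = e^{iα_j} f(c_j^-)`, `f'(c_j^+) = -e^{iα_j} f'(c_j^-)` at the new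
ones, with derivatives taken into the edges. -/
structure VertexConditions (α : Fin Γ.betti → ℝ) (f f₁ : TreeEdge c → ℝ → ℂ) : Prop where
  delta : ∀ v : V, (cutTree c).DeltaCondition f f₁ (Sum.inl v) (Γ.χ v)
  jump : ∀ j, (cutTree c).endValue f (Sum.inr (j, true)) false =
    Complex.exp (Complex.I * α j) * (cutTree c).endValue f (Sum.inr (j, false)) true
  jump_deriv : ∀ j, (cutTree c).endDeriv f₁ (Sum.inr (j, true)) false =
    -Complex.exp (Complex.I * α j) * (cutTree c).endDeriv f₁ (Sum.inr (j, false)) true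

/-- `(u, w)` is in the graph of `H^α`: `u` is (the class of) a function `f` that is `H²` on every
edge and satisfies the vertex conditions, and `w = -f'' + q f`. -/
def InGraph (α : Fin Γ.betti → ℝ) (u w : GraphL2 (cutTree c)) : Prop :=
  ∃ f f₁ f₂ : TreeEdge c → ℝ → ℂ,
    (∀ e, IsSobolevTwo ((cutTree c).length e) (f e) (f₁ e) (f₂ e)) ∧
    VertexConditions Γ c α f f₁ ∧
    (∀ e, u e =ᵐ[volume.restrict (Icc 0 ((cutTree c).length e))] f e) ∧
    (∀ e, w e =ᵐ[volume.restrict (Icc 0 ((cutTree c).length e))]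
      fun x => -f₂ e x + (treePotential Γ c e x : ℂ) * f e x)

end Operator

theorem IsSobolevTwo.integrable {L : ℝ} {f f₁ f₂ : ℝ → ℂ} (h : IsSobolevTwo L f f₁ f₂) :
    IntegrableOn f₂ (Icc 0 L) :=
  h.memLp.integrable (by norm_num)

theorem IsSobolevTwo.intervalIntegrable {L : ℝ} {f f₁ f₂ : ℝ → ℂ} (h : IsSobolevTwo L f f₁ f₂)
    {x : ℝ} (hx : x ∈ Icc 0 L) : IntervalIntegrable f₂ volume 0 x := by
  rw [intervalIntegrable_iff_integrableOn_Icc_of_le hx.1]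
  exact h.integrable.mono_set (Icc_subset_Icc_right hx.2)

theorem IsSobolevTwo.continuousOn_snd {L : ℝ} {f f₁ f₂ : ℝ → ℂ} (h : IsSobolevTwo L f f₁ f₂) :
    ContinuousOn f₁ (Icc 0 L) :=
  (continuousOn_const.add (intervalIntegral.continuousOn_primitive h.integrable)).congr
    fun x hx => by
      rw [h.snd x hx, intervalIntegral.integral_of_le hx.1]
      rfl

theorem IsSobolevTwo.intervalIntegrable_snd {L : ℝ} {f f₁ f₂ : ℝ → ℂ} (h : IsSobolevTwo L f f₁ f₂)
    {x : ℝ} (hx : x ∈ Icc 0 L) : IntervalIntegrable f₁ volume 0 x := by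
  refine ContinuousOn.intervalIntegrable ?_
  rw [uIcc_of_le hx.1]
  exact h.continuousOn_snd.mono (Icc_subset_Icc_right hx.2)

theorem IsSobolevTwo.continuousOn {L : ℝ} {f f₁ f₂ : ℝ → ℂ} (h : IsSobolevTwo L f f₁ f₂) :
    ContinuousOn f (Icc 0 L) :=
  (continuousOn_const.add (intervalIntegral.continuousOn_primitive
    (h.continuousOn_snd.integrableOn_compact isCompact_Icc))).congr
    fun x hx => by
      rw [h.fst x hx, intervalIntegral.integral_of_le hx.1]
      rfl

theorem IsSobolevTwo.zero (L : ℝ) : IsSobolevTwo L 0 0 0 :=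
  ⟨MemLp.zero, fun _ _ => by simp, fun _ _ => by simp⟩

theorem IsSobolevTwo.add {L : ℝ} {f f₁ f₂ g g₁ g₂ : ℝ → ℂ} (hf : IsSobolevTwo L f f₁ f₂)
    (hg : IsSobolevTwo L g g₁ g₂) : IsSobolevTwo L (f + g) (f₁ + g₁) (f₂ + g₂) := by
  refine ⟨hf.memLp.add hg.memLp, fun x hx => ?_, fun x hx => ?_⟩
  · simp only [Pi.add_apply]
    rw [intervalIntegral.integral_add (hf.intervalIntegrable hx) (hg.intervalIntegrable hx),
      hf.snd x hx, hg.snd x hx]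
    ring
  · simp only [Pi.add_apply]
    rw [intervalIntegral.integral_add (hf.intervalIntegrable_snd hx) (hg.intervalIntegrable_snd hx),
      hf.fst x hx, hg.fst x hx]
    ring

theorem IsSobolevTwo.smul {L : ℝ} {f f₁ f₂ : ℝ → ℂ} (z : ℂ) (hf : IsSobolevTwo L f f₁ f₂) :
    IsSobolevTwo L (z • f) (z • f₁) (z • f₂) := by
  refine ⟨hf.memLp.const_smul z, fun x hx => ?_, fun x hx => ?_⟩
  · simp only [Pi.smul_apply]
    rw [intervalIntegral.integral_smul, hf.snd x hx, smul_add]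
  · simp only [Pi.smul_apply]
    rw [intervalIntegral.integral_smul, hf.fst x hx, smul_add]

theorem MetricGraph.DeltaCondition.comb {V E : Type*} [Fintype E] {G : MetricGraph V E}
    {f f₁ g g₁ : E → ℝ → ℂ} {v : V} {χ : WithTop ℝ} (z y : ℂ) (hf : G.DeltaCondition f f₁ v χ)
    (hg : G.DeltaCondition g g₁ v χ) : G.DeltaCondition (z • f + y • g) (z • f₁ + y • g₁) v χ := by
  obtain ⟨a, ha, ha', hfa⟩ := hf
  obtain ⟨b, hb, hb', hgb⟩ := hg
  refine ⟨z * a + y * b, fun e s hs => ?_, fun h => by simp [ha' h, hb' h], fun r hr => ?_⟩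
  · rw [← ha e s hs, ← hb e s hs]
    cases s <;> simp [endValue]
  · have := congrArg₂ (fun p q => z * p + y * q) (hfa r hr) (hgb r hr)
    simp only [Finset.mul_sum, ← Finset.sum_add_distrib] at this
    rw [show (r : ℂ) * (z * a + y * b) = z * (r * a) + y * (r * b) by ring, ← this]
    refine Finset.sum_congr rfl fun h _ => ?_
    split_ifs
    · rcases h with ⟨e, _ | _⟩ <;> simp [endDeriv] <;> ring
    · simp

theorem VertexConditions.comb {V E : Type*} [Fintype V] [Fintype E] {Γ : QuantumGraph V E}
    {c : Cut Γ.toMetricGraph} {α : Fin Γ.betti → ℝ} {f f₁ g g₁ : TreeEdge c → ℝ → ℂ} (z y : ℂ)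
    (hf : VertexConditions Γ c α f f₁) (hg : VertexConditions Γ c α g g₁) :
    VertexConditions Γ c α (z • f + y • g) (z • f₁ + y • g₁) := by
  refine ⟨fun v => (hf.delta v).comb z y (hg.delta v), fun j => ?_, fun j => ?_⟩
  · have h1 := hf.jump j
    have h2 := hg.jump j
    simp only [MetricGraph.endValue] at h1 h2
    simp only [MetricGraph.endValue, Pi.add_apply, Pi.smul_apply, smul_eq_mul, h1, h2]
    ring
  · have h1 := hf.jump_deriv j
    have h2 := hg.jump_deriv j
    simp only [MetricGraph.endDeriv] at h1 h2
    simp only [MetricGraph.endDeriv, Pi.add_apply, Pi.smul_apply, smul_eq_mul, h1, h2]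
    ring

theorem InGraph.zero {V E : Type*} [Fintype V] [Fintype E] {Γ : QuantumGraph V E}
    {c : Cut Γ.toMetricGraph} {α : Fin Γ.betti → ℝ} : InGraph Γ c α 0 0 := by
  refine ⟨0, 0, 0, fun e => IsSobolevTwo.zero _, ⟨fun v => ⟨0, ?_, ?_, ?_⟩, ?_, ?_⟩, fun e => ?_,
    fun e => ?_⟩
  · rintro e (_ | _) - <;> simp [MetricGraph.endValue]
  · simp
  · intro r _
    rw [mul_zero]
    refine Finset.sum_eq_zero fun h _ => ?_
    rcases h with ⟨e, _ | _⟩ <;> simp [MetricGraph.endDeriv]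
  · simp [MetricGraph.endValue]
  · simp [MetricGraph.endDeriv]
  · exact Lp.coeFn_zero _ _ _
  · refine (Lp.coeFn_zero _ _ _).trans (Eventually.of_forall fun x => ?_)
    simp

theorem InGraph.comb {V E : Type*} [Fintype V] [Fintype E] {Γ : QuantumGraph V E}
    {c : Cut Γ.toMetricGraph} {α : Fin Γ.betti → ℝ} (z y : ℂ) {u w u' w' : GraphL2 (cutTree c)}
    (h : InGraph Γ c α u w) (h' : InGraph Γ c α u' w') :
    InGraph Γ c α (z • u + y • u') (z • w + y • w') := by
  obtain ⟨f, f₁, f₂, hS, hV, hu, hw⟩ := h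
  obtain ⟨g, g₁, g₂, hS', hV', hu', hw'⟩ := h'
  refine ⟨z • f + y • g, z • f₁ + y • g₁, z • f₂ + y • g₂,
    fun e => ((hS e).smul z).add ((hS' e).smul y), hV.comb z y hV', fun e => ?_, fun e => ?_⟩
  · filter_upwards [Lp.coeFn_add (z • u e) (y • u' e), Lp.coeFn_smul z (u e),
      Lp.coeFn_smul y (u' e), hu e, hu' e] with x h1 h2 h3 h4 h5
    refine h1.trans ?_
    simp [h2, h3, h4, h5]
  · filter_upwards [Lp.coeFn_add (z • w e) (y • w' e), Lp.coeFn_smul z (w e),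
      Lp.coeFn_smul y (w' e), hw e, hw' e] with x h1 h2 h3 h4 h5
    refine h1.trans ?_
    simp only [h2, h3, h4, h5, Pi.add_apply, Pi.smul_apply, smul_eq_mul]
    ring

theorem ae_zero_of_primitive_zero {L : ℝ} (hL : 0 < L) {g : ℝ → ℂ} (hg : IntegrableOn g (Icc 0 L))
    (h : ∀ x ∈ Icc 0 L, ∫ t in (0 : ℝ)..x, g t = 0) : g =ᵐ[volume.restrict (Icc 0 L)] 0 := by
  have hg' : IntervalIntegrable g volume 0 L :=
    (intervalIntegrable_iff_integrableOn_Icc_of_le hL.le).2 hg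
  have h0 : ∀ᵐ x : ℝ, x ≠ 0 := by simp [ae_iff, measure_singleton]
  have h1 : ∀ᵐ x : ℝ, x ≠ L := by simp [ae_iff, measure_singleton]
  rw [EventuallyEq, ae_restrict_iff' measurableSet_Icc]
  filter_upwards [hg'.ae_hasDerivAt_integral, h0, h1] with x hx hx0 hx1 hm
  have hd := hx (by rwa [uIcc_of_le hL.le]) 0 left_mem_uIcc
  refine hd.unique ((hasDerivAt_const x (0 : ℂ)).congr_of_eventuallyEq ?_)
  filter_upwards [Icc_mem_nhds (lt_of_le_of_ne hm.1 hx0.symm) (lt_of_le_of_ne hm.2 hx1)] with y hy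
  exact h y hy

/-- `H^α` is single valued. -/
theorem InGraph.eq_zero {V E : Type*} [Fintype V] [Fintype E] {Γ : QuantumGraph V E}
    {c : Cut Γ.toMetricGraph} {α : Fin Γ.betti → ℝ} {w : GraphL2 (cutTree c)}
    (h : InGraph Γ c α 0 w) : w = 0 := by
  obtain ⟨f, f₁, f₂, hS, -, hu, hw⟩ := h
  ext1 e
  have hL := (cutTree c).length_pos e
  have hf : EqOn (f e) 0 (Icc 0 ((cutTree c).length e)) := by
    refine Measure.eqOn_Icc_of_ae_eq volume hL.ne ?_ (hS e).continuousOn continuousOn_const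
    refine (hu e).symm.trans ?_
    exact Lp.coeFn_zero _ _ _
  have h1 : EqOn (f₁ e) 0 (Icc 0 ((cutTree c).length e)) := by
    refine Measure.eqOn_Icc_of_ae_eq volume hL.ne ?_ (hS e).continuousOn_snd continuousOn_const
    refine ae_zero_of_primitive_zero hL ((hS e).continuousOn_snd.integrableOn_compact isCompact_Icc) ?_
    intro x hx
    have := (hS e).fst x hx
    rw [hf hx, hf (left_mem_Icc.2 hL.le)] at this
    simpa using this.symm
  have h2 : f₂ e =ᵐ[volume.restrict (Icc 0 ((cutTree c).length e))] 0 := by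
    refine ae_zero_of_primitive_zero hL (hS e).integrable ?_
    intro x hx
    have := (hS e).snd x hx
    rw [h1 hx, h1 (left_mem_Icc.2 hL.le)] at this
    simpa using this.symm
  refine Lp.ext ((hw e).trans ?_)
  refine EventuallyEq.trans ?_ (Lp.coeFn_zero _ _ _).symm
  filter_upwards [h2, ae_restrict_mem measurableSet_Icc] with x hx hm
  rw [hx, hf hm]
  simp

section Operator

variable {V E : Type*} [Fintype V] [Fintype E] (Γ : QuantumGraph V E) (c : Cut Γ.toMetricGraph)

/-- The graph of `H^α` as a linear subspace. -/
def opGraph (α : Fin Γ.betti → ℝ) :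
    Submodule ℂ (GraphL2 (cutTree c) × GraphL2 (cutTree c)) where
  carrier := {p | InGraph Γ c α p.1 p.2}
  zero_mem' := InGraph.zero
  add_mem' := by
    intro p p' h h'
    simpa using InGraph.comb 1 1 h h'
  smul_mem' := by
    intro z p h
    simpa using InGraph.comb z 0 h h

/-- The operator `H^α` in `L²(T)`. -/
def magneticOp (α : Fin Γ.betti → ℝ) : GraphL2 (cutTree c) →ₗ.[ℂ] GraphL2 (cutTree c) :=
  (opGraph Γ c α).toLinearPMap

/-- The graph of `H^α` is the intended one. -/
theorem mem_graph_magneticOp (α : Fin Γ.betti → ℝ) (u w : GraphL2 (cutTree c)) :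
    (u, w) ∈ (magneticOp Γ c α).graph ↔ InGraph Γ c α u w := by
  rw [magneticOp, Submodule.toLinearPMap_graph_eq]
  · rfl
  · rintro ⟨x, y⟩ hx rfl
    exact InGraph.eq_zero hx

end Operator

/-! ### Spectrum, multiplicity, ordered eigenvalues of an unbounded operator -/

section Spectrum

variable {H : Type*} [NormedAddCommGroup H] [NormedSpace ℂ H]

/-- The spectrum of an unbounded operator: the `z` for which `A - z` has no bounded two-sided
inverse `R : H → dom A`. -/
def spec (A : H →ₗ.[ℂ] H) : Set ℂ :=
  {z | ¬ ∃ R : H →L[ℂ] H,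
    (∀ w : H, ∃ h : R w ∈ A.domain, A ⟨R w, h⟩ - z • R w = w) ∧
    ∀ u : A.domain, R (A u - z • (u : H)) = u}

/-- The eigenspace `ker (A - z)`. -/
def eigenspace (A : H →ₗ.[ℂ] H) (z : ℂ) : Submodule ℂ H :=
  (LinearMap.ker (A.toFun - z • A.domain.subtype)).map A.domain.subtype

/-- The multiplicity of `z` as an eigenvalue (zero if it is not one). -/
def multiplicity (A : H →ₗ.[ℂ] H) (z : ℂ) : Cardinal := Module.rank ℂ (eigenspace A z)

/-- The number of eigenvalues in `(-∞, t]`, counted with multiplicity: the dimension of the sum of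
their (linearly independent) eigenspaces. -/
def eigenCount (A : H →ₗ.[ℂ] H) (t : ℝ) : Cardinal :=
  Module.rank ℂ (⨆ s ∈ Iic t, eigenspace A (s : ℂ) : Submodule ℂ H)

/-- The `n`-th eigenvalue (`n = 1, 2, …`), in increasing order and counted with multiplicity, of an
operator that is bounded from below with discrete spectrum. -/
def nthEigenvalue (A : H →ₗ.[ℂ] H) (n : ℕ) : ℝ :=
  sInf {t : ℝ | (n : Cardinal) ≤ eigenCount A t}

end Spectrum

/-- The set `Σ` of points all of whose coordinates are `0` or `π`. -/
def symmetryPoints (β : ℕ) : Set (Fin β → ℝ) :=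
  {ς | ∃ b : Fin β → Fin 2, ς = fun j => Real.pi * ((b j : ℕ) : ℝ)}

end QG

end

/-!
Complex conjugation `f ↦ f̄` turns the factors `e^{iα_j}` of the vertex conditions into `e^{-iα_j}`
and changes nothing else in `H^α`. Since `e^{iς_j} = ±1` is real, it carries `H^(ς-α)` to
`H^(ς+α)`. Both operators are self-adjoint, so their spectra are real and unaffected by the
conjugation.

Hence `α ↦ λ_n(ς + α)` is even, and its derivative at `0` vanishes as soon as it exists. A solution
of `(H^α + K) f = g` is determined by `f''` and by the Cauchy data of `f` on each edge. These solve
a linear equation whose operator is a compact perturbation of the identity and is differentiable in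
`α`. By the Fredholm alternative, for large `K` the resolvents `R(α) = (H^α + K)⁻¹` are compact,
positive and differentiable in `α`. If the `n`-th eigenvalue `μ` of `R(ς)` is simple, with unit
eigenvector `v`, and `D = R(α) - R(ς)`, then the min-max principle puts the `n`-th eigenvalue of
`R(α)` within `C ‖D‖²` of `μ + Re ⟨D v, v⟩`, so that it is differentiable at `ς`.
-/

noncomputable section

namespace QG

/-! ### Compact symmetric operators -/

section CompactOperator

variable {𝕜 H : Type*} [RCLike 𝕜] [NormedAddCommGroup H] [InnerProductSpace 𝕜 H]

/-- The algebraic sum of the eigenspaces of `R` with real eigenvalue in `I`. For a compact symmetric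
`R` and `I = [m, ∞)` with `m > 0` it is finite-dimensional, and its dimension is the number of
eigenvalues in `I`, with multiplicity. -/
def eigenspaceSum (R : H →L[𝕜] H) (I : Set ℝ) : Submodule 𝕜 H :=
  ⨆ ν ∈ I, Module.End.eigenspace (R : Module.End 𝕜 H) (ν : 𝕜)

variable {R : H →L[𝕜] H} {I J : Set ℝ} {m μ : ℝ} {x : H}

theorem eigenspaceSum_mono (h : I ⊆ J) : eigenspaceSum R I ≤ eigenspaceSum R J :=
  biSup_mono fun _ hi => h hi

theorem eigenspace_le_eigenspaceSum (h : μ ∈ I) :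
    Module.End.eigenspace (R : Module.End 𝕜 H) (μ : 𝕜) ≤ eigenspaceSum R I :=
  le_biSup (fun ν : ℝ => Module.End.eigenspace (R : Module.End 𝕜 H) (ν : 𝕜)) h

theorem eigenspaceSum_insert :
    eigenspaceSum R (insert μ I) =
      Module.End.eigenspace (R : Module.End 𝕜 H) (μ : 𝕜) ⊔ eigenspaceSum R I :=
  iSup_insert

theorem eigenspaceSum_eq_of_subset (h : I ⊆ J)
    (hJ : ∀ ν ∈ J \ I, Module.End.eigenspace (R : Module.End 𝕜 H) (ν : 𝕜) = ⊥) :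
    eigenspaceSum R I = eigenspaceSum R J := by
  refine le_antisymm (eigenspaceSum_mono h) (iSup₂_le fun ν hν => ?_)
  by_cases hI : ν ∈ I
  · exact eigenspace_le_eigenspaceSum hI
  · exact (hJ ν ⟨hν, hI⟩).trans_le bot_le

theorem isOrtho_eigenspaceSum (hR : R.IsSymmetric) (h : Disjoint I J) :
    eigenspaceSum R I ⟂ eigenspaceSum R J := by
  simp only [eigenspaceSum, Submodule.isOrtho_iSup_left, Submodule.isOrtho_iSup_right]
  intro ν hν ξ hξ
  refine hR.orthogonalFamily_eigenspaces.isOrtho fun h' => ?_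
  exact disjoint_left.1 h hξ (RCLike.ofReal_injective h' ▸ hν)

theorem exists_finsupp_of_mem_eigenspaceSum (hR : R.IsSymmetric) (hx : x ∈ eigenspaceSum R I) :
    ∃ f : I →₀ H, ‖x‖ ^ 2 = ∑ ν ∈ f.support, ‖f ν‖ ^ 2 ∧
      R.reApplyInnerSelf x = ∑ ν ∈ f.support, (ν : ℝ) * ‖f ν‖ ^ 2 := by
  rw [eigenspaceSum, iSup_subtype', Submodule.mem_iSup_iff_exists_finsupp] at hx
  obtain ⟨f, hf, rfl⟩ := hx
  have hortho := hR.orthogonalFamily_eigenspaces.comp (f := fun ν : I => ((ν : ℝ) : 𝕜))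
    (RCLike.ofReal_injective.comp Subtype.val_injective)
  let l (ν : I) : Module.End.eigenspace (R : Module.End 𝕜 H) ((ν : ℝ) : 𝕜) := ⟨f ν, hf ν⟩
  refine ⟨f, hortho.norm_sum l f.support, ?_⟩
  have hRf : R (f.sum fun _ y => y) = ∑ ν ∈ f.support, ((((ν : ℝ) : 𝕜) • l ν : _) : H) := by
    rw [Finsupp.sum, map_sum]
    exact Finset.sum_congr rfl fun ν _ => Module.End.mem_eigenspace_iff.1 (hf ν)
  have hinner := hortho.inner_sum (fun ν => ((ν : ℝ) : 𝕜) • l ν) l f.support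
  rw [R.reApplyInnerSelf_apply, hRf]
  refine (congrArg RCLike.re hinner).trans ?_
  rw [map_sum]
  refine Finset.sum_congr rfl fun ν _ => ?_
  rw [inner_smul_left, RCLike.conj_ofReal, RCLike.re_ofReal_mul, inner_self_eq_norm_sq]
  rfl

theorem mul_norm_sq_le_of_mem_eigenspaceSum (hR : R.IsSymmetric)
    (hx : x ∈ eigenspaceSum R (Ici m)) : m * ‖x‖ ^ 2 ≤ R.reApplyInnerSelf x := by
  obtain ⟨f, hnorm, hform⟩ := exists_finsupp_of_mem_eigenspaceSum hR hx
  rw [hnorm, hform, Finset.mul_sum]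
  exact Finset.sum_le_sum fun ν _ => mul_le_mul_of_nonneg_right ν.2 (sq_nonneg _)

theorem le_mul_norm_sq_of_mem_closure_eigenspaceSum (hR : R.IsSymmetric)
    (hx : x ∈ (eigenspaceSum R (Iic m)).topologicalClosure) :
    R.reApplyInnerSelf x ≤ m * ‖x‖ ^ 2 := by
  have hclosed : IsClosed {y : H | R.reApplyInnerSelf y ≤ m * ‖y‖ ^ 2} :=
    isClosed_le R.reApplyInnerSelf_continuous (by fun_prop)
  refine closure_minimal (fun y hy => ?_) hclosed hx
  obtain ⟨f, hnorm, hform⟩ := exists_finsupp_of_mem_eigenspaceSum hR hy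
  rw [mem_ofPred_eq, hnorm, hform, Finset.mul_sum]
  exact Finset.sum_le_sum fun ν _ => mul_le_mul_of_nonneg_right ν.2 (sq_nonneg _)

theorem mul_norm_le_norm_apply_of_mem_closure_eigenspaceSum (hR : R.IsSymmetric)
    (hx : x ∈ (eigenspaceSum R (Ici m)).topologicalClosure) : m * ‖x‖ ≤ ‖R x‖ := by
  have hclosed : IsClosed {y : H | m * ‖y‖ ≤ ‖R y‖} := isClosed_le (by fun_prop) (by fun_prop)
  refine closure_minimal (fun y hy => ?_) hclosed hx
  have hform := mul_norm_sq_le_of_mem_eigenspaceSum hR hy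
  have hcauchy : R.reApplyInnerSelf y ≤ ‖R y‖ * ‖y‖ := re_inner_le_norm _ _
  rcases (norm_nonneg y).eq_or_lt with h0 | h0
  · simp [← h0]
  · exact le_of_mul_le_mul_right (by nlinarith) h0

theorem exists_mem_orthogonal_of_rank_lt {F S : Submodule 𝕜 H} [FiniteDimensional 𝕜 F]
    (h : Module.rank 𝕜 F < Module.rank 𝕜 S) : ∃ x ∈ S, x ∈ Fᗮ ∧ x ≠ 0 := by
  by_contra! hcon
  let P : S →ₗ[𝕜] F := F.orthogonalProjectionOnto.toLinearMap ∘ₗ S.subtype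
  refine h.not_ge (LinearMap.rank_le_of_injective P ?_)
  rw [← LinearMap.ker_eq_bot, LinearMap.ker_eq_bot']
  intro x hx
  exact Subtype.ext (hcon x x.2 (Submodule.orthogonalProjectionOnto_eq_zero_iff.1 hx))

theorem rank_eigenspaceSum_le (hR : R.IsSymmetric) {F : Submodule 𝕜 H} [FiniteDimensional 𝕜 F]
    {m' : ℝ} (hF : ∀ x ∈ Fᗮ, R.reApplyInnerSelf x ≤ m * ‖x‖ ^ 2) (hm : m < m') :
    Module.rank 𝕜 (eigenspaceSum R (Ici m')) ≤ Module.rank 𝕜 F := by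
  by_contra! h
  obtain ⟨x, hxS, hxF, hx0⟩ := exists_mem_orthogonal_of_rank_lt h
  have hlower := mul_norm_sq_le_of_mem_eigenspaceSum hR hxS
  have hupper := hF x hxF
  have hpos : 0 < ‖x‖ ^ 2 := by positivity
  nlinarith

theorem finiteDimensional_eigenspaceSum [CompleteSpace H] (hc : IsCompactOperator R)
    (hR : R.IsSymmetric) (hm : 0 < m) : FiniteDimensional 𝕜 (eigenspaceSum R (Ici m)) := by
  set N := (eigenspaceSum R (Ici m)).topologicalClosure
  have : CompleteSpace N := (Submodule.isClosed_topologicalClosure _).completeSpace_coe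
  set g : N →L[𝕜] H := R.comp N.subtypeL
  have hanti : AntilipschitzWith (Real.toNNReal m⁻¹) g := by
    refine ContinuousLinearMap.antilipschitz_of_bound _ fun x => ?_
    rw [Real.coe_toNNReal _ (by positivity), inv_mul_eq_div, le_div_iff₀ hm, mul_comm]
    exact mul_norm_le_norm_apply_of_mem_closure_eigenspaceSum hR x.2
  have hemb := hanti.isClosedEmbedding g.uniformContinuous
  have hgc : IsCompactOperator g := hc.comp_clm N.subtypeL
  obtain ⟨K, hK, hKs⟩ := hgc.image_closedBall_subset_compact 1
  have hball : IsCompact (Metric.closedBall (0 : N) 1) :=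
    (hemb.isCompact_preimage hK).of_isClosed_subset Metric.isClosed_closedBall
      fun x hx => hKs ⟨x, hx, rfl⟩
  have : FiniteDimensional 𝕜 N := FiniteDimensional.of_isCompact_closedBall 𝕜 one_pos hball
  exact Submodule.finiteDimensional_of_le (Submodule.le_topologicalClosure _)

theorem finite_eigenvalues_ge [CompleteSpace H] (hc : IsCompactOperator R) (hR : R.IsSymmetric)
    (hm : 0 < m) :
    {ν : ℝ | m ≤ ν ∧ Module.End.eigenspace (R : Module.End 𝕜 H) (ν : 𝕜) ≠ ⊥}.Finite := by
  have := finiteDimensional_eigenspaceSum hc hR hm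
  set T := {ν : ℝ | m ≤ ν ∧ Module.End.eigenspace (R : Module.End 𝕜 H) (ν : 𝕜) ≠ ⊥}
  have hex (ν : T) : ∃ x : eigenspaceSum R (Ici m),
      Module.End.HasEigenvector (R : Module.End 𝕜 H) ((ν : ℝ) : 𝕜) x := by
    obtain ⟨x, hx, hx0⟩ := Submodule.exists_mem_ne_zero_of_ne_bot ν.2.2
    exact ⟨⟨x, eigenspace_le_eigenspaceSum ν.2.1 hx⟩, hx, hx0⟩
  choose x hx using hex
  have hli : LinearIndependent 𝕜 ((eigenspaceSum R (Ici m)).subtype ∘ x) :=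
    Module.End.eigenvectors_linearIndependent' (R : Module.End 𝕜 H) (fun ν : T => ((ν : ℝ) : 𝕜))
      (RCLike.ofReal_injective.comp Subtype.val_injective) _ hx
  exact finite_coe_iff.1 (LinearIndependent.of_comp _ hli).finite

theorem exists_isolating_eigenvalue [CompleteSpace H] (hc : IsCompactOperator R)
    (hR : R.IsSymmetric) (hμ : 0 < μ) : ∃ δ > 0, δ < μ ∧ ∀ ν ∈ Icc (μ - δ) (μ + δ), ν ≠ μ →
      Module.End.eigenspace (R : Module.End 𝕜 H) (ν : 𝕜) = ⊥ := by
  have hT := (finite_eigenvalues_ge hc hR (half_pos hμ)).subset (sdiff_subset (t := {μ}))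
  obtain ⟨ε, hε, hball⟩ := Metric.mem_nhds_iff.1 <|
    hT.isClosed.isOpen_compl.mem_nhds (by simp : μ ∈ _)
  have hδε : min (ε / 2) (μ / 2) ≤ ε / 2 := min_le_left _ _
  have hδμ : min (ε / 2) (μ / 2) ≤ μ / 2 := min_le_right _ _
  refine ⟨min (ε / 2) (μ / 2), by positivity, by linarith, fun ν hν hne => ?_⟩
  by_contra hbot
  have hνball : ν ∈ Metric.ball μ ε := by
    rw [Metric.mem_ball, Real.dist_eq, abs_lt]
    constructor <;> linarith [hν.1, hν.2]
  exact hball hνball ⟨⟨by linarith [hν.1], hbot⟩, hne⟩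

theorem exists_eigenspaceSum_gap [CompleteSpace H] (hc : IsCompactOperator R) (hR : R.IsSymmetric)
    (hμ : 0 < μ) : ∃ δ > 0, δ < μ ∧ eigenspaceSum R (Ici μ) = eigenspaceSum R (Ici (μ - δ)) ∧
      eigenspaceSum R (Ioi μ) = eigenspaceSum R (Ici (μ + δ)) := by
  obtain ⟨δ, hδ, hδμ, hgap⟩ := exists_isolating_eigenvalue hc hR hμ
  refine ⟨δ, hδ, hδμ, eigenspaceSum_eq_of_subset (Ici_subset_Ici.2 (by linarith)) ?_,
    (eigenspaceSum_eq_of_subset (Ici_subset_Ioi.2 (by linarith)) ?_).symm⟩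
  · rintro ν ⟨hν, hνμ⟩
    have hlt : ν < μ := not_le.1 hνμ
    exact hgap ν ⟨hν, by linarith⟩ hlt.ne
  · rintro ν ⟨hν : μ < ν, hνμ⟩
    exact hgap ν ⟨by linarith, (not_le.1 hνμ).le⟩ hν.ne'

theorem orthogonal_eigenspaceSum_le [CompleteSpace H] (hc : IsCompactOperator R)
    (hR : R.IsSymmetric) (hIJ : IsCompl I J) :
    (eigenspaceSum R I)ᗮ ≤ (eigenspaceSum R J).topologicalClosure := by
  intro x hx
  set N := (eigenspaceSum R J).topologicalClosure
  have : CompleteSpace N := (Submodule.isClosed_topologicalClosure _).completeSpace_coe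
  have hNI : N ≤ (eigenspaceSum R I)ᗮ :=
    Submodule.topologicalClosure_minimal _ (isOrtho_eigenspaceSum hR hIJ.disjoint).symm
      (Submodule.isClosed_orthogonal _)
  obtain ⟨a, ha, b, hb, rfl⟩ := N.exists_add_mem_mem_orthogonal x
  have hbI : b ∈ (eigenspaceSum R I)ᗮ := by simpa using Submodule.sub_mem _ hx (hNI ha)
  have hbJ : b ∈ (eigenspaceSum R J)ᗮ :=
    Submodule.orthogonal_le (Submodule.le_topologicalClosure _) hb
  have hb0 : b ∈ (⨆ μ, Module.End.eigenspace (R : Module.End 𝕜 H) μ)ᗮ := by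
    rw [← Submodule.iInf_orthogonal, Submodule.mem_iInf]
    intro μ
    by_cases hμ : Module.End.eigenspace (R : Module.End 𝕜 H) μ = ⊥
    · simp [hμ]
    · obtain ⟨ν, rfl⟩ := RCLike.conj_eq_iff_real.1 (hR.conj_eigenvalue_eq_self hμ)
      rcases (hIJ.sup_eq_top.ge (mem_univ ν) : ν ∈ I ∪ J) with h | h
      · exact Submodule.orthogonal_le (eigenspace_le_eigenspaceSum h) hbI
      · exact Submodule.orthogonal_le (eigenspace_le_eigenspaceSum h) hbJ
  rw [ContinuousLinearMap.orthogonalComplement_iSup_eigenspaces_eq_bot hc hR,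
    Submodule.mem_bot] at hb0
  simpa [hb0] using ha

theorem le_mul_norm_sq_of_mem_orthogonal_eigenspaceSum [CompleteSpace H]
    (hc : IsCompactOperator R) (hR : R.IsSymmetric) (hx : x ∈ (eigenspaceSum R (Ici m))ᗮ) :
    R.reApplyInnerSelf x ≤ m * ‖x‖ ^ 2 := by
  have hcompl : IsCompl (Ici m) (Iio m) := compl_Ici (a := m) ▸ isCompl_compl
  exact le_mul_norm_sq_of_mem_closure_eigenspaceSum hR <| Submodule.topologicalClosure_mono
    (eigenspaceSum_mono Iio_subset_Iic_self) (orthogonal_eigenspaceSum_le hc hR hcompl hx)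

theorem rank_le_rank_eigenspaceSum [CompleteSpace H] (hc : IsCompactOperator R)
    (hR : R.IsSymmetric) {S : Submodule 𝕜 H} {m' : ℝ}
    (hS : ∀ x ∈ S, m * ‖x‖ ^ 2 ≤ R.reApplyInnerSelf x) (hm' : 0 < m') (hm : m' < m) :
    Module.rank 𝕜 S ≤ Module.rank 𝕜 (eigenspaceSum R (Ici m')) := by
  by_contra! h
  have := finiteDimensional_eigenspaceSum hc hR hm'
  obtain ⟨x, hxS, hxo, hx0⟩ := exists_mem_orthogonal_of_rank_lt h
  have hupper := le_mul_norm_sq_of_mem_orthogonal_eigenspaceSum hc hR hxo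
  have hlower := hS x hxS
  have hpos : 0 < ‖x‖ ^ 2 := by positivity
  nlinarith

theorem exists_pos_mul_norm_sq_le {F : Type*} [NormedAddCommGroup F] [InnerProductSpace 𝕜 F]
    [FiniteDimensional 𝕜 F] {Q : F → ℝ} (hcont : Continuous Q)
    (hsmul : ∀ (a : 𝕜) (x : F), Q (a • x) = ‖a‖ ^ 2 * Q x) (hpos : ∀ x, x ≠ 0 → 0 < Q x) :
    ∃ m > 0, ∀ x, m * ‖x‖ ^ 2 ≤ Q x := by
  have : ProperSpace F := FiniteDimensional.proper_rclike 𝕜 F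
  have hzero : Q 0 = 0 := by simpa using hsmul 0 0
  rcases subsingleton_or_nontrivial F with hF | hF
  · exact ⟨1, one_pos, fun x => by simp [Subsingleton.elim x 0, hzero]⟩
  obtain ⟨y, hy⟩ := exists_ne (0 : F)
  obtain ⟨x₀, hx₀, hmin⟩ := (isCompact_sphere (0 : F) 1).exists_isMinOn
    ⟨((‖y‖⁻¹ : ℝ) : 𝕜) • y, by simp [norm_smul, norm_ne_zero_iff.2 hy]⟩ hcont.continuousOn
  refine ⟨Q x₀, hpos x₀ (ne_zero_of_mem_unit_sphere ⟨x₀, hx₀⟩), fun x => ?_⟩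
  rcases eq_or_ne x 0 with rfl | hx
  · simp [hzero]
  have hunit : ((‖x‖⁻¹ : ℝ) : 𝕜) • x ∈ Metric.sphere (0 : F) 1 := by
    simp [norm_smul, norm_ne_zero_iff.2 hx]
  calc Q x₀ * ‖x‖ ^ 2 ≤ Q (((‖x‖⁻¹ : ℝ) : 𝕜) • x) * ‖x‖ ^ 2 := by gcongr; exact hmin hunit
    _ = Q x := by
      have := norm_ne_zero_iff.2 hx
      rw [hsmul, RCLike.norm_ofReal, sq_abs]
      field_simp

theorem exists_le_rank_eigenspaceSum [CompleteSpace H] (hc : IsCompactOperator R)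
    (hR : R.IsSymmetric) (hpos : ∀ x, x ≠ 0 → 0 < R.reApplyInnerSelf x)
    (hinf : ¬ FiniteDimensional 𝕜 H) (n : ℕ) :
    ∃ m > 0, (n : Cardinal) ≤ Module.rank 𝕜 (eigenspaceSum R (Ici m)) := by
  have hrank : (n : Cardinal) ≤ Module.rank 𝕜 H :=
    Cardinal.natCast_lt_aleph0.le.trans (not_lt.1 (mt Module.rank_lt_aleph0_iff.1 hinf))
  obtain ⟨s, hs, hli⟩ := exists_finset_linearIndependent_of_le_rank hrank
  set S := Submodule.span 𝕜 (s : Set H)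
  have : FiniteDimensional 𝕜 S := FiniteDimensional.span_finset 𝕜 s
  have hSrank : Module.rank 𝕜 S = n := by
    rw [rank_span_set hli]
    simp [hs]
  obtain ⟨m, hm, hbound⟩ := exists_pos_mul_norm_sq_le (𝕜 := 𝕜) (F := S)
    (Q := fun x => R.reApplyInnerSelf (x : H))
    (R.reApplyInnerSelf_continuous.comp continuous_subtype_val)
    (fun a x => R.reApplyInnerSelf_smul x) (fun x hx => hpos x (by simpa using hx))
  exact ⟨m / 2, half_pos hm, hSrank.ge.trans <| rank_le_rank_eigenspaceSum hc hR
    (fun x hx => hbound ⟨x, hx⟩) (half_pos hm) (half_lt_self hm)⟩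

end CompactOperator

/-! ### Perturbation of a simple eigenvalue -/

section Perturbation

variable {𝕜 H : Type*} [RCLike 𝕜] [NormedAddCommGroup H] [InnerProductSpace 𝕜 H]
  {A P : H →L[𝕜] H} {v x y : H} {μ δ : ℝ}

theorem reApplyInnerSelf_add (x : H) :
    (A + P).reApplyInnerSelf x = A.reApplyInnerSelf x + P.reApplyInnerSelf x := by
  simp only [ContinuousLinearMap.reApplyInnerSelf_apply, add_apply, inner_add_left, map_add]

theorem reApplyInnerSelf_neg (x : H) : (-A).reApplyInnerSelf x = -A.reApplyInnerSelf x := by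
  simp only [ContinuousLinearMap.reApplyInnerSelf_apply, neg_apply, inner_neg_left, map_neg]

theorem norm_smul_add_sq_of_inner_eq_zero (hv : ‖v‖ = 1) (hy : inner 𝕜 v y = 0) (c : 𝕜) :
    ‖c • v + y‖ ^ 2 = ‖c‖ ^ 2 + ‖y‖ ^ 2 := by
  have h := norm_add_sq_eq_norm_sq_add_norm_sq_of_inner_eq_zero (𝕜 := 𝕜) (c • v) y
    (by rw [inner_smul_left, hy, mul_zero])
  rw [norm_smul, hv, mul_one] at h
  simpa only [sq] using h

theorem reApplyInnerSelf_smul_add_of_inner_eq_zero (hA : A.IsSymmetric) (hv : ‖v‖ = 1)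
    (hAv : A v = (μ : 𝕜) • v) (hy : inner 𝕜 v y = 0) (c : 𝕜) :
    A.reApplyInnerSelf (c • v + y) = μ * ‖c‖ ^ 2 + A.reApplyInnerSelf y := by
  have hAyv : inner 𝕜 (A y) v = 0 := by
    have : inner 𝕜 (A y) v = inner 𝕜 y (A v) := hA y v
    rw [this, hAv, inner_smul_right, inner_eq_zero_symm.1 hy, mul_zero]
  have hcross : inner 𝕜 (A y) (c • v) = 0 := by rw [inner_smul_right, hAyv, mul_zero]
  have hcross' : inner 𝕜 (A (c • v)) y = 0 := by
    rw [map_smul, hAv, inner_smul_left, inner_smul_left, hy, mul_zero, mul_zero]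
  have hdiag : A.reApplyInnerSelf (c • v) = μ * ‖c‖ ^ 2 := by
    rw [A.reApplyInnerSelf_smul, A.reApplyInnerSelf_apply, hAv, inner_smul_left,
      RCLike.conj_ofReal, RCLike.re_ofReal_mul, inner_self_eq_norm_sq, hv]
    ring
  rw [← hdiag]
  simp only [A.reApplyInnerSelf_apply, map_add, inner_add_left, inner_add_right, hcross, hcross',
    add_zero, zero_add]

theorem re_inner_apply_le (P : H →L[𝕜] H) (x y : H) :
    RCLike.re (inner 𝕜 (P x) y) ≤ ‖P‖ * ‖x‖ * ‖y‖ :=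
  (re_inner_le_norm _ _).trans (mul_le_mul_of_nonneg_right (P.le_opNorm x) (norm_nonneg y))

theorem reApplyInnerSelf_smul_add_le (P : H →L[𝕜] H) (hv : ‖v‖ = 1) (c : 𝕜) :
    P.reApplyInnerSelf (c • v + y) ≤
      P.reApplyInnerSelf v * ‖c‖ ^ 2 + 2 * ‖P‖ * ‖c‖ * ‖y‖ + ‖P‖ * ‖y‖ ^ 2 := by
  have hexpand : P.reApplyInnerSelf (c • v + y) = P.reApplyInnerSelf (c • v) +
      RCLike.re (inner 𝕜 (P (c • v)) y) + RCLike.re (inner 𝕜 (P y) (c • v)) +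
      P.reApplyInnerSelf y := by
    simp only [P.reApplyInnerSelf_apply, map_add, inner_add_left, inner_add_right]
    ring
  have hcv : ‖c • v‖ = ‖c‖ := by rw [norm_smul, hv, mul_one]
  have hvy := re_inner_apply_le P (c • v) y
  have hyv := re_inner_apply_le P y (c • v)
  have hyy : P.reApplyInnerSelf y ≤ ‖P‖ * ‖y‖ * ‖y‖ := re_inner_apply_le P y y
  rw [hcv] at hvy hyv
  rw [hexpand, P.reApplyInnerSelf_smul]
  nlinarith

theorem abs_reApplyInnerSelf_le (P : H →L[𝕜] H) (hv : ‖v‖ = 1) :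
    |P.reApplyInnerSelf v| ≤ ‖P‖ := by
  refine (RCLike.abs_re_le_norm _).trans ((norm_inner_le_norm _ _).trans ?_)
  simpa [hv] using P.le_opNorm v

theorem reApplyInnerSelf_add_perturbation_le (hA : A.IsSymmetric) (hδ : 0 < δ) (hv : ‖v‖ = 1)
    (hAv : A v = (μ : 𝕜) • v) (hy : inner 𝕜 v y = 0)
    (hAy : A.reApplyInnerSelf y ≤ (μ - δ) * ‖y‖ ^ 2) (hP : ‖P‖ ≤ δ / 4) (c : 𝕜) :
    (A + P).reApplyInnerSelf (c • v + y) ≤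
      (μ + P.reApplyInnerSelf v + 2 / δ * ‖P‖ ^ 2) * ‖c • v + y‖ ^ 2 := by
  have hPle := reApplyInnerSelf_smul_add_le P (y := y) hv c
  have hPv := (abs_le.1 (abs_reApplyInnerSelf_le P hv)).1
  rw [reApplyInnerSelf_add, reApplyInnerSelf_smul_add_of_inner_eq_zero hA hv hAv hy,
    norm_smul_add_sq_of_inner_eq_zero hv hy]
  set p := P.reApplyInnerSelf v
  set ε := ‖P‖
  -- Half of the spectral gap `δ` absorbs the cross term.
  have hcross : 2 * ε * ‖c‖ * ‖y‖ ≤ 2 / δ * ε ^ 2 * ‖c‖ ^ 2 + δ / 2 * ‖y‖ ^ 2 := by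
    have hsq : 2 / δ * ε ^ 2 * ‖c‖ ^ 2 + δ / 2 * ‖y‖ ^ 2 - 2 * ε * ‖c‖ * ‖y‖ =
        2 / δ * (ε * ‖c‖ - δ / 2 * ‖y‖) ^ 2 := by
      field_simp
      ring
    have hnonneg : 0 ≤ 2 / δ * (ε * ‖c‖ - δ / 2 * ‖y‖) ^ 2 := by positivity
    linarith
  have hεy : 0 ≤ 2 / δ * ε ^ 2 * ‖y‖ ^ 2 := by positivity
  have hgap : 0 ≤ (δ / 2 + p - ε) * ‖y‖ ^ 2 := mul_nonneg (by linarith) (sq_nonneg _)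
  nlinarith

theorem exists_norm_eq_one_span_eq_of_rank_eq_one {S : Submodule 𝕜 H}
    (hS : Module.rank 𝕜 S = 1) : ∃ v, ‖v‖ = 1 ∧ S = 𝕜 ∙ v := by
  obtain ⟨w, hwS, hw0, hspan⟩ := (rank_submodule_eq_one_iff S).1 hS
  have hw : ‖w‖ ≠ 0 := norm_ne_zero_iff.2 hw0
  have hunit : IsUnit ((‖w‖⁻¹ : ℝ) : 𝕜) := by simp [hw]
  refine ⟨((‖w‖⁻¹ : ℝ) : 𝕜) • w, by simp [norm_smul, hw], ?_⟩
  rw [Submodule.span_singleton_smul_eq hunit]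
  exact le_antisymm hspan ((Submodule.span_singleton_le_iff_mem _ _).2 hwS)

theorem inner_eq_zero_of_mem_eigenspaceSum_Ioi (hA : A.IsSymmetric) (hAv : A v = (μ : 𝕜) • v)
    (hy : y ∈ eigenspaceSum A (Ioi μ)) : inner 𝕜 v y = 0 :=
  Submodule.isOrtho_iff_inner_eq.1 (isOrtho_eigenspaceSum hA (I := {μ}) (by simp)) v
    (eigenspace_le_eigenspaceSum (mem_singleton μ) (Module.End.mem_eigenspace_iff.2 hAv)) y hy

theorem mem_eigenspaceSum_Ici_iff
    (hspan : Module.End.eigenspace (A : Module.End 𝕜 H) (μ : 𝕜) = 𝕜 ∙ v) :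
    x ∈ eigenspaceSum A (Ici μ) ↔ ∃ c : 𝕜, ∃ y ∈ eigenspaceSum A (Ioi μ), c • v + y = x := by
  rw [← Ioi_insert, eigenspaceSum_insert, hspan, Submodule.mem_sup]
  simp only [Submodule.mem_span_singleton, exists_exists_eq_and]

theorem apply_eq_smul_of_eigenspace_eq_span
    (hspan : Module.End.eigenspace (A : Module.End 𝕜 H) (μ : 𝕜) = 𝕜 ∙ v) :
    A v = (μ : 𝕜) • v :=
  Module.End.mem_eigenspace_iff.1 (hspan ▸ Submodule.mem_span_singleton_self v)

theorem mul_norm_sq_le_reApplyInnerSelf_add_of_mem_eigenspaceSum (hA : A.IsSymmetric)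
    (hδ : 0 < δ) (hv : ‖v‖ = 1)
    (hspan : Module.End.eigenspace (A : Module.End 𝕜 H) (μ : 𝕜) = 𝕜 ∙ v)
    (hgap : eigenspaceSum A (Ioi μ) = eigenspaceSum A (Ici (μ + δ))) (hP : ‖P‖ ≤ δ / 4)
    (hx : x ∈ eigenspaceSum A (Ici μ)) :
    (μ + P.reApplyInnerSelf v - 2 / δ * ‖P‖ ^ 2) * ‖x‖ ^ 2 ≤ (A + P).reApplyInnerSelf x := by
  obtain ⟨c, y, hy, rfl⟩ := (mem_eigenspaceSum_Ici_iff hspan).1 hx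
  have hAv := apply_eq_smul_of_eigenspace_eq_span hspan
  have hAy := mul_norm_sq_le_of_mem_eigenspaceSum hA (hgap ▸ hy)
  have hnegA : (-A).IsSymmetric := fun a b => by
    have : inner 𝕜 (A a) b = inner 𝕜 a (A b) := hA a b
    simp [this]
  have h := reApplyInnerSelf_add_perturbation_le (P := -P) (μ := -μ) hnegA hδ hv (by simp [hAv])
    (inner_eq_zero_of_mem_eigenspaceSum_Ioi hA hAv hy)
    (by rw [reApplyInnerSelf_neg]; linarith) (by rwa [norm_neg]) c
  rw [← neg_add, norm_neg, reApplyInnerSelf_neg, reApplyInnerSelf_neg] at h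
  linarith

variable [CompleteSpace H]

theorem reApplyInnerSelf_add_le_of_mem_orthogonal_eigenspaceSum (hc : IsCompactOperator A)
    (hA : A.IsSymmetric) (hδ : 0 < δ) (hv : ‖v‖ = 1)
    (hspan : Module.End.eigenspace (A : Module.End 𝕜 H) (μ : 𝕜) = 𝕜 ∙ v)
    (hgap : eigenspaceSum A (Ici μ) = eigenspaceSum A (Ici (μ - δ))) (hP : ‖P‖ ≤ δ / 4)
    (hx : x ∈ (eigenspaceSum A (Ioi μ))ᗮ) :
    (A + P).reApplyInnerSelf x ≤ (μ + P.reApplyInnerSelf v + 2 / δ * ‖P‖ ^ 2) * ‖x‖ ^ 2 := by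
  have hAv := apply_eq_smul_of_eigenspace_eq_span hspan
  set y := x - (inner 𝕜 v x : 𝕜) • v with hy
  have hxy : x = (inner 𝕜 v x : 𝕜) • v + y := by rw [hy, add_sub_cancel]
  have hvy : inner 𝕜 v y = 0 := by
    rw [hy, inner_sub_right, inner_smul_right, inner_self_eq_norm_sq_to_K, hv]
    simp
  have hyIoi : ∀ z ∈ eigenspaceSum A (Ioi μ), inner 𝕜 z y = 0 := fun z hz => by
    rw [hy, inner_sub_right, (Submodule.mem_orthogonal _ _).1 hx z hz, inner_smul_right,
      inner_eq_zero_symm.1 (inner_eq_zero_of_mem_eigenspaceSum_Ioi hA hAv hz), mul_zero, sub_zero]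
  have hyIci : y ∈ (eigenspaceSum A (Ici μ))ᗮ := by
    refine (Submodule.mem_orthogonal _ _).2 fun z hz => ?_
    obtain ⟨c, w, hw, rfl⟩ := (mem_eigenspaceSum_Ici_iff hspan).1 hz
    rw [inner_add_left, inner_smul_left, hvy, hyIoi w hw, mul_zero, add_zero]
  rw [hxy]
  exact reApplyInnerSelf_add_perturbation_le hA hδ hv hAv hvy
    (le_mul_norm_sq_of_mem_orthogonal_eigenspaceSum hc hA (hgap ▸ hyIci)) hP _

theorem exists_rank_eigenspaceSum_perturbation (hc : IsCompactOperator A) (hA : A.IsSymmetric)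
    (hμ : 0 < μ) (hsimple : Module.rank 𝕜 (Module.End.eigenspace (A : Module.End 𝕜 H) (μ : 𝕜)) = 1)
    {n : ℕ} (hbelow : ∀ m, 0 < m → m < μ → (n : Cardinal) ≤ Module.rank 𝕜 (eigenspaceSum A (Ici m)))
    (habove : ∀ m, μ < m → Module.rank 𝕜 (eigenspaceSum A (Ici m)) < n) :
    ∃ (v : H) (C : ℝ), ∃ ε > 0, ∀ R : H →L[𝕜] H, IsCompactOperator R → R.IsSymmetric →
      ‖R - A‖ ≤ ε →
      (∀ m, 0 < m → m < μ + (R - A).reApplyInnerSelf v - C * ‖R - A‖ ^ 2 →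
        (n : Cardinal) ≤ Module.rank 𝕜 (eigenspaceSum R (Ici m))) ∧
      ∀ m, μ + (R - A).reApplyInnerSelf v + C * ‖R - A‖ ^ 2 < m →
        Module.rank 𝕜 (eigenspaceSum R (Ici m)) < n := by
  obtain ⟨δ, hδ, hδμ, hge, hgt⟩ := exists_eigenspaceSum_gap hc hA hμ
  obtain ⟨v, hv, hspan⟩ := exists_norm_eq_one_span_eq_of_rank_eq_one hsimple
  refine ⟨v, 2 / δ, δ / 4, by positivity, fun R hRc hR hRA => ⟨fun m hm0 hm => ?_, fun m hm => ?_⟩⟩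
  · refine (hbelow (μ - δ) (by linarith) (by linarith)).trans ?_
    rw [← hge]
    refine rank_le_rank_eigenspaceSum hRc hR (fun x hx => ?_) hm0 hm
    simpa only [add_sub_cancel] using
      mul_norm_sq_le_reApplyInnerSelf_add_of_mem_eigenspaceSum hA hδ hv hspan hgt hRA hx
  · refine lt_of_le_of_lt ?_ (habove (μ + δ) (by linarith))
    rw [← hgt]
    have : FiniteDimensional 𝕜 (eigenspaceSum A (Ioi μ)) :=
      hgt ▸ finiteDimensional_eigenspaceSum hc hA (by linarith)
    refine rank_eigenspaceSum_le hR (fun x hx => ?_) hm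
    simpa only [add_sub_cancel] using
      reApplyInnerSelf_add_le_of_mem_orthogonal_eigenspaceSum hc hA hδ hv hspan hge hRA hx

end Perturbation

/-! ### Eigenvalues of an operator with compact resolvent -/

section Resolvent

variable {H : Type*} [NormedAddCommGroup H] [InnerProductSpace ℂ H]

/-- `R` behaves like the resolvent `(T + K)⁻¹` of an operator `T > -K`, as far as real eigenvalues
and eigenvectors are concerned. -/
structure EigenResolvent (T : H →ₗ.[ℂ] H) (K : ℝ) (R : H →L[ℂ] H) : Prop where
  eigenspace_eq_bot : ∀ s : ℝ, s ≤ -K → eigenspace T (s : ℂ) = ⊥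
  eigenspace_eq : ∀ s : ℝ, -K < s →
    eigenspace T (s : ℂ) = Module.End.eigenspace (R : Module.End ℂ H) (((s + K)⁻¹ : ℝ) : ℂ)

variable {T : H →ₗ.[ℂ] H} {K : ℝ} {R : H →L[ℂ] H} {n : ℕ}

theorem EigenResolvent.eigenCount_of_le (h : EigenResolvent T K R) {t : ℝ} (ht : t ≤ -K) :
    eigenCount T t = 0 := by
  have hbot : (⨆ s ∈ Iic t, eigenspace T (s : ℂ) : Submodule ℂ H) = ⊥ :=
    iSup₂_eq_bot.2 fun s hs => h.eigenspace_eq_bot s (le_trans hs ht)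
  rw [eigenCount, hbot, rank_bot]

theorem EigenResolvent.eigenCount_eq (h : EigenResolvent T K R) {t : ℝ} (ht : -K < t) :
    eigenCount T t = Module.rank ℂ (eigenspaceSum R (Ici (t + K)⁻¹)) := by
  suffices (⨆ s ∈ Iic t, eigenspace T (s : ℂ) : Submodule ℂ H) =
      eigenspaceSum R (Ici (t + K)⁻¹) by rw [eigenCount, this]
  refine le_antisymm (iSup₂_le fun s (hs : s ≤ t) => ?_)
    (iSup₂_le fun ν (hν : (t + K)⁻¹ ≤ ν) => ?_)
  · rcases le_or_gt s (-K) with hsK | hsK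
    · exact (h.eigenspace_eq_bot s hsK).trans_le bot_le
    · rw [h.eigenspace_eq s hsK]
      exact eigenspace_le_eigenspaceSum (inv_anti₀ (by linarith : 0 < s + K) (by linarith))
  · have hpos : 0 < (t + K)⁻¹ := inv_pos.2 (by linarith)
    have hνK : -K < ν⁻¹ - K := by linarith [inv_pos.2 (hpos.trans_le hν)]
    have hνt : ν⁻¹ ≤ t + K := inv_inv (t + K) ▸ inv_anti₀ hpos hν
    have hspace := h.eigenspace_eq _ hνK
    rw [sub_add_cancel, inv_inv] at hspace
    refine hspace.ge.trans ?_
    exact le_biSup (fun s : ℝ => eigenspace T (s : ℂ)) (mem_Iic.2 (by linarith))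

theorem EigenResolvent.eigenCount_inv_sub (h : EigenResolvent T K R) {m : ℝ} (hm : 0 < m) :
    eigenCount T (m⁻¹ - K) = Module.rank ℂ (eigenspaceSum R (Ici m)) := by
  rw [h.eigenCount_eq (by linarith [inv_pos.2 hm]), sub_add_cancel, inv_inv]

theorem EigenResolvent.neg_lt_of_le_eigenCount (h : EigenResolvent T K R) {t : ℝ} (hn : 1 ≤ n)
    (ht : (n : Cardinal) ≤ eigenCount T t) : -K < t := by
  by_contra! hle
  rw [h.eigenCount_of_le hle, nonpos_iff_eq_zero, Nat.cast_eq_zero] at ht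
  omega

theorem EigenResolvent.bddBelow_setOf_le_eigenCount (h : EigenResolvent T K R) (hn : 1 ≤ n) :
    BddBelow {t : ℝ | (n : Cardinal) ≤ eigenCount T t} :=
  ⟨-K, fun _ ht => (h.neg_lt_of_le_eigenCount hn ht).le⟩

theorem EigenResolvent.nthEigenvalue_le (h : EigenResolvent T K R) (hn : 1 ≤ n) {m : ℝ}
    (hm : 0 < m) (hle : (n : Cardinal) ≤ Module.rank ℂ (eigenspaceSum R (Ici m))) :
    nthEigenvalue T n ≤ m⁻¹ - K :=
  csInf_le (h.bddBelow_setOf_le_eigenCount hn) (hle.trans_eq (h.eigenCount_inv_sub hm).symm)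

theorem EigenResolvent.le_rank_eigenspaceSum_of_lt (h : EigenResolvent T K R) (hn : 1 ≤ n)
    (hne : ∃ m₀ > 0, (n : Cardinal) ≤ Module.rank ℂ (eigenspaceSum R (Ici m₀))) {m : ℝ}
    (hm : 0 < m) (hlt : nthEigenvalue T n < m⁻¹ - K) :
    (n : Cardinal) ≤ Module.rank ℂ (eigenspaceSum R (Ici m)) := by
  obtain ⟨m₀, hm₀, hle⟩ := hne
  obtain ⟨t, ht, htm⟩ := exists_lt_of_csInf_lt
    ⟨m₀⁻¹ - K, hle.trans_eq (h.eigenCount_inv_sub hm₀).symm⟩ hlt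
  have htK := h.neg_lt_of_le_eigenCount hn ht
  rw [mem_ofPred_eq, h.eigenCount_eq htK] at ht
  refine ht.trans (Submodule.rank_mono (eigenspaceSum_mono (Ici_subset_Ici.2 ?_)))
  rw [le_inv_comm₀ hm (by linarith)]
  linarith

theorem EigenResolvent.nthEigenvalue_mem_Icc (h : EigenResolvent T K R) (hn : 1 ≤ n) {a b : ℝ}
    (ha : 0 < a) (hb : 0 < b)
    (hle : ∀ m, 0 < m → m < a → (n : Cardinal) ≤ Module.rank ℂ (eigenspaceSum R (Ici m)))
    (hlt : ∀ m, b < m → Module.rank ℂ (eigenspaceSum R (Ici m)) < n) :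
    nthEigenvalue T n ∈ Icc (b⁻¹ - K) (a⁻¹ - K) := by
  constructor
  · have hne := hle (a / 2) (half_pos ha) (half_lt_self ha)
    rw [← h.eigenCount_inv_sub (half_pos ha)] at hne
    refine le_csInf ⟨_, hne⟩ fun t ht => ?_
    have htK := h.neg_lt_of_le_eigenCount hn ht
    by_contra! hcon
    refine (hlt (t + K)⁻¹ ?_).not_ge (ht.trans_eq (h.eigenCount_eq htK))
    rw [lt_inv_comm₀ hb (by linarith)]
    linarith
  · have hlim : Tendsto (fun m : ℝ => m⁻¹ - K) (𝓝[<] a) (𝓝 (a⁻¹ - K)) :=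
      ((tendsto_inv₀ ha.ne').mono_left nhdsWithin_le_nhds).sub_const K
    refine ge_of_tendsto hlim ?_
    filter_upwards [self_mem_nhdsWithin, nhdsWithin_le_nhds (lt_mem_nhds ha)] with m hma hm
    exact h.nthEigenvalue_le hn hm (hle m hm hma)

theorem hasFDerivAt_of_eventuallyLE {X : Type*} [NormedAddCommGroup X] [NormedSpace ℝ X]
    {f l u : X → ℝ} {f' : X →L[ℝ] ℝ} {x : X} (hl : HasFDerivAt l f' x) (hu : HasFDerivAt u f' x)
    (hlf : l ≤ᶠ[𝓝 x] f) (hfu : f ≤ᶠ[𝓝 x] u) (hx : l x = u x) : HasFDerivAt f f' x := by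
  have hlx : l x = f x := le_antisymm hlf.self_of_nhds (hx ▸ hfu.self_of_nhds)
  rw [hasFDerivAt_iff_isLittleO, Asymptotics.isLittleO_iff] at hl hu ⊢
  rw [← hx] at hu
  rw [← hlx]
  intro r hr
  filter_upwards [hl hr, hu hr, hlf, hfu] with y hly huy hlfy hfuy
  rw [Real.norm_eq_abs, abs_le] at hly huy ⊢
  exact ⟨by linarith [hly.1], by linarith [huy.2]⟩

theorem hasFDerivAt_mul_norm_sub_sq {X Y : Type*} [NormedAddCommGroup X] [NormedSpace ℝ X]
    [NormedAddCommGroup Y] [NormedSpace ℝ Y] {f : X → Y} {x₀ : X} (hf : DifferentiableAt ℝ f x₀)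
    (C : ℝ) : HasFDerivAt (fun x => C * ‖f x - f x₀‖ ^ 2) (0 : X →L[ℝ] ℝ) x₀ := by
  have hO : (fun x => ‖f x - f x₀‖ ^ 2) =O[𝓝 x₀] fun x => ‖x - x₀‖ ^ 2 :=
    hf.isBigO_sub.norm_norm.pow 2
  have ho := hO.trans_isLittleO (Asymptotics.isLittleO_pow_sub_sub x₀ one_lt_two)
  rw [hasFDerivAt_iff_isLittleO]
  simpa using ho.const_mul_left C

theorem differentiableAt_reApplyInnerSelf_sub {X : Type*} [NormedAddCommGroup X] [NormedSpace ℝ X]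
    {R : X → H →L[ℂ] H} {x₀ : X} (hR : DifferentiableAt ℝ R x₀) (v : H) :
    DifferentiableAt ℝ (fun x => (R x - R x₀).reApplyInnerSelf v) x₀ := by
  have happly : DifferentiableAt ℝ (fun x => (R x - R x₀) v) x₀ :=
    ((ContinuousLinearMap.apply ℂ H v).restrictScalars ℝ).differentiableAt.comp x₀
      (hR.sub_const _)
  have hinner : DifferentiableAt ℝ (fun x => inner ℂ v ((R x - R x₀) v)) x₀ :=
    ((innerSL ℂ v).restrictScalars ℝ).differentiableAt.comp x₀ happly
  refine (Complex.reCLM.differentiableAt.comp x₀ hinner).congr_of_eventuallyEq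
    (Eventually.of_forall fun x => ?_)
  exact (RCLike.conj_re (inner ℂ ((R x - R x₀) v) v)).symm.trans
    (congrArg Complex.re (inner_conj_symm _ _))

variable [CompleteSpace H]

theorem EigenResolvent.exists_nthEigenvalue_perturbation (h : EigenResolvent T K R)
    (hc : IsCompactOperator R) (hR : R.IsSymmetric) (hn : 1 ≤ n)
    (hne : ∃ m₀ > 0, (n : Cardinal) ≤ Module.rank ℂ (eigenspaceSum R (Ici m₀)))
    (hsimple : multiplicity T (nthEigenvalue T n : ℂ) = 1) :
    ∃ μ > 0, ∃ (v : H) (C : ℝ), ∃ ε > 0, ∀ (T' : H →ₗ.[ℂ] H) (R' : H →L[ℂ] H),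
      EigenResolvent T' K R' → IsCompactOperator R' → R'.IsSymmetric → ‖R' - R‖ < ε →
      0 < μ + (R' - R).reApplyInnerSelf v - C * ‖R' - R‖ ^ 2 →
      0 < μ + (R' - R).reApplyInnerSelf v + C * ‖R' - R‖ ^ 2 →
      nthEigenvalue T' n ∈
        Icc ((μ + (R' - R).reApplyInnerSelf v + C * ‖R' - R‖ ^ 2)⁻¹ - K)
          ((μ + (R' - R).reApplyInnerSelf v - C * ‖R' - R‖ ^ 2)⁻¹ - K) := by
  set l := nthEigenvalue T n with hl
  have hlK : -K < l := by
    by_contra! hle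
    rw [multiplicity, h.eigenspace_eq_bot l hle, rank_bot] at hsimple
    exact zero_ne_one hsimple
  have hμ : 0 < (l + K)⁻¹ := inv_pos.2 (by linarith)
  have hbelow (m : ℝ) (hm : 0 < m) (hml : m < (l + K)⁻¹) :=
    h.le_rank_eigenspaceSum_of_lt hn hne hm
      (by linarith [(lt_inv_comm₀ hm (by linarith : 0 < l + K)).1 hml])
  have habove (m : ℝ) (hm : (l + K)⁻¹ < m) : Module.rank ℂ (eigenspaceSum R (Ici m)) < n := by
    by_contra! hle
    linarith [h.nthEigenvalue_le hn (hμ.trans hm) hle, inv_lt_of_inv_lt₀ (by linarith) hm]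
  rw [multiplicity, h.eigenspace_eq l hlK] at hsimple
  obtain ⟨v, C, ε, hε, hpert⟩ :=
    exists_rank_eigenspaceSum_perturbation hc hR hμ hsimple hbelow habove
  refine ⟨_, hμ, v, C, ε, hε, fun T' R' h' hc' hR' hlt hpos hpos' => ?_⟩
  obtain ⟨hle, hlt⟩ := hpert R' hc' hR' hlt.le
  exact h'.nthEigenvalue_mem_Icc hn hpos hpos' hle hlt

theorem EigenResolvent.differentiableAt_nthEigenvalue {X : Type*} [NormedAddCommGroup X]
    [NormedSpace ℝ X] {T : X → H →ₗ.[ℂ] H} {R : X → H →L[ℂ] H}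
    (h : ∀ x, EigenResolvent (T x) K (R x)) (hc : ∀ x, IsCompactOperator (R x))
    (hR : ∀ x, (R x).IsSymmetric) {x₀ : X} (hd : DifferentiableAt ℝ R x₀) (hn : 1 ≤ n)
    (hne : ∃ m₀ > 0, (n : Cardinal) ≤ Module.rank ℂ (eigenspaceSum (R x₀) (Ici m₀)))
    (hsimple : multiplicity (T x₀) (nthEigenvalue (T x₀) n : ℂ) = 1) :
    DifferentiableAt ℝ (fun x => nthEigenvalue (T x) n) x₀ := by
  obtain ⟨μ, hμ, v, C, ε, hε, hpert⟩ :=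
    (h x₀).exists_nthEigenvalue_perturbation (hc x₀) (hR x₀) hn hne hsimple
  obtain ⟨p', hp⟩ := (differentiableAt_reApplyInnerSelf_sub hd v).const_add μ
  have hq := hasFDerivAt_mul_norm_sub_sq hd C
  have hlower := sub_zero p' ▸ hp.sub hq
  have hupper := add_zero p' ▸ hp.add hq
  have hv : (0 : H →L[ℂ] H).reApplyInnerSelf v = 0 := by
    simp [ContinuousLinearMap.reApplyInnerSelf_apply]
  have hinv {g : X → ℝ} (hg : HasFDerivAt g p' x₀) (hg0 : g x₀ = μ) :
      HasFDerivAt (fun x => (g x)⁻¹ - K) (-(μ ^ 2)⁻¹ • p') x₀ := by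
    subst hg0
    exact ((hasDerivAt_inv hμ.ne').comp_hasFDerivAt x₀ hg).sub_const K
  have hclose : ∀ᶠ x in 𝓝 x₀, ‖R x - R x₀‖ < ε :=
    (hd.continuousAt.sub_const _).norm.eventually_lt_const (by simpa using hε)
  have hmem : ∀ᶠ x in 𝓝 x₀, nthEigenvalue (T x) n ∈
      Icc ((μ + (R x - R x₀).reApplyInnerSelf v + C * ‖R x - R x₀‖ ^ 2)⁻¹ - K)
        ((μ + (R x - R x₀).reApplyInnerSelf v - C * ‖R x - R x₀‖ ^ 2)⁻¹ - K) := by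
    filter_upwards [hclose, hlower.continuousAt.eventually_const_lt (by simpa [hv] using hμ),
      hupper.continuousAt.eventually_const_lt (by simpa [hv] using hμ)] with x hx hxl hxu
    exact hpert (T x) (R x) (h x) (hc x) (hR x) hx hxl hxu
  exact ⟨_, hasFDerivAt_of_eventuallyLE (hinv hupper (by simp [hv])) (hinv hlower (by simp [hv]))
    (hmem.mono fun _ hx => hx.1) (hmem.mono fun _ hx => hx.2) (by simp)⟩

end Resolvent

/-! ### Integration by parts for primitives -/

section Primitive

variable {F : Type*} [NormedAddCommGroup F] [NormedSpace ℝ F] {a b : ℝ}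

theorem absolutelyContinuousOnInterval_primitive {w : ℝ → F}
    (h : IntervalIntegrable w volume a b) :
    AbsolutelyContinuousOnInterval (fun x => ∫ t in a..x, w t) a b := by
  have hn := h.norm.absolutelyContinuousOnInterval_intervalIntegral left_mem_uIcc
  rw [absolutelyContinuousOnInterval_iff] at hn ⊢
  intro ε hε
  obtain ⟨δ, hδ, H⟩ := hn ε hε
  refine ⟨δ, hδ, fun E hE hlt => lt_of_le_of_lt (Finset.sum_le_sum fun i hi => ?_) (H E hE hlt)⟩
  obtain ⟨h1, h2⟩ := hE.1 i hi
  have hsub : ∀ {y}, y ∈ uIcc a b → IntervalIntegrable w volume a y := fun hy =>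
    h.mono_set (uIcc_subset_uIcc left_mem_uIcc hy)
  rw [dist_comm, dist_eq_norm, intervalIntegral.integral_interval_sub_left (hsub h2) (hsub h1),
    dist_comm, Real.dist_eq,
    intervalIntegral.integral_interval_sub_left (hsub h2).norm (hsub h1).norm]
  exact intervalIntegral.norm_integral_le_abs_integral_norm

theorem integral_eq_sub_of_absolutelyContinuousOnInterval [CompleteSpace F] {f f' : ℝ → F}
    (hf : AbsolutelyContinuousOnInterval f a b) (hf' : IntervalIntegrable f' volume a b)
    (hd : ∀ᵐ x, x ∈ uIcc a b → HasDerivAt f (f' x) x) :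
    ∫ t in a..b, f' t = f b - f a := by
  have hac := hf.fun_sub (absolutelyContinuousOnInterval_primitive hf')
  obtain ⟨C, hC⟩ := hac.const_of_ae_hasDerivAt_zero <| by
    filter_upwards [hd, hf'.ae_hasDerivAt_integral] with x h1 h2 hx
    simpa only [sub_self] using (h1 hx).fun_sub (h2 hx a left_mem_uIcc)
  have ha := hC a left_mem_uIcc
  have hb := hC b right_mem_uIcc
  rw [intervalIntegral.integral_same, sub_zero] at ha
  rw [ha, ← hb, sub_sub_cancel]

theorem integral_mul_add_mul_eq_sub {A : Type*} [NormedRing A] [NormMulClass A]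
    [NormedAlgebra ℝ A] [CompleteSpace A] {u u' v v' : ℝ → A}
    (hu' : IntervalIntegrable u' volume a b) (hv' : IntervalIntegrable v' volume a b)
    (hu : ∀ x ∈ uIcc a b, u x = u a + ∫ t in a..x, u' t)
    (hv : ∀ x ∈ uIcc a b, v x = v a + ∫ t in a..x, v' t) :
    ∫ t in a..b, (u' t * v t + u t * v' t) = u b * v b - u a * v a := by
  let U : ℝ → A := fun x => u a + ∫ t in a..x, u' t
  let W : ℝ → A := fun x => v a + ∫ t in a..x, v' t
  have hconst (z : A) : AbsolutelyContinuousOnInterval (fun _ => z) a b :=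
    contDiffOn_const.absolutelyContinuousOnInterval
  have hU : AbsolutelyContinuousOnInterval U a b :=
    (hconst (u a)).fun_add (absolutelyContinuousOnInterval_primitive hu')
  have hW : AbsolutelyContinuousOnInterval W a b :=
    (hconst (v a)).fun_add (absolutelyContinuousOnInterval_primitive hv')
  have hUW := integral_eq_sub_of_absolutelyContinuousOnInterval
    (f' := fun t => u' t * W t + U t * v' t) (hU.smul hW)
    ((hu'.mul_continuousOn hW.continuousOn).add (hv'.continuousOn_mul hU.continuousOn)) <| by
      filter_upwards [hu'.ae_hasDerivAt_integral, hv'.ae_hasDerivAt_integral] with x h1 h2 hx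
      exact ((h1 hx a left_mem_uIcc).const_add (u a)).mul ((h2 hx a left_mem_uIcc).const_add (v a))
  calc ∫ t in a..b, (u' t * v t + u t * v' t)
      = ∫ t in a..b, (u' t * W t + U t * v' t) :=
        intervalIntegral.integral_congr fun t ht => by simp only [U, W, ← hu t ht, ← hv t ht]
    _ = U b * W b - U a * W a := hUW
    _ = u b * v b - u a * v a := by
        simp only [U, W, ← hu _ left_mem_uIcc, ← hv _ left_mem_uIcc, ← hu _ right_mem_uIcc,
          ← hv _ right_mem_uIcc]

end Primitive

namespace IsSobolevTwo

variable {L : ℝ} {f f₁ f₂ g g₁ g₂ : ℝ → ℂ}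

theorem conj (h : IsSobolevTwo L f f₁ f₂) :
    IsSobolevTwo L (fun x => star (f x)) (fun x => star (f₁ x)) (fun x => star (f₂ x)) := by
  refine ⟨h.memLp.star, fun x hx => ?_, fun x hx => ?_⟩
  · simp only [h.snd x hx, star_add, Complex.star_def]
    rw [intervalIntegral.integral_of_le hx.1, intervalIntegral.integral_of_le hx.1, integral_conj]
  · simp only [h.fst x hx, star_add, Complex.star_def]
    rw [intervalIntegral.integral_of_le hx.1, intervalIntegral.integral_of_le hx.1, integral_conj]

theorem fst_eq_add_integral (h : IsSobolevTwo L f f₁ f₂) {x y : ℝ} (hx : x ∈ Icc 0 L)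
    (hy : y ∈ Icc 0 L) : f y = f x + ∫ t in x..y, f₁ t := by
  rw [← intervalIntegral.integral_interval_sub_left (h.intervalIntegrable_snd hy)
    (h.intervalIntegrable_snd hx), h.fst y hy, h.fst x hx]
  ring

theorem green (hL : 0 ≤ L) (hf : IsSobolevTwo L f f₁ f₂) (hg : IsSobolevTwo L g g₁ g₂) :
    ∫ x in Icc 0 L, star (g x) * -f₂ x = (∫ x in Icc 0 L, star (g₁ x) * f₁ x) +
      (star (g 0) * f₁ 0 + star (g L) * -f₁ L) := by
  have hmem : L ∈ Icc 0 L := right_mem_Icc.2 hL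
  have h := integral_mul_add_mul_eq_sub (hg.conj.intervalIntegrable_snd hmem)
    (hf.intervalIntegrable hmem) (by simpa only [uIcc_of_le hL] using hg.conj.fst)
    (by simpa only [uIcc_of_le hL] using hf.snd)
  rw [intervalIntegral.integral_of_le hL, ← integral_Icc_eq_integral_Ioc, integral_add] at h
  · simp only [mul_neg, integral_neg]
    linear_combination -h
  · exact (hg.conj.continuousOn_snd.mul hf.continuousOn_snd).integrableOn_compact isCompact_Icc
  · exact hf.integrable.continuousOn_mul hg.conj.continuousOn isCompact_Icc

theorem integrableOn_normSq (hf : IsSobolevTwo L f f₁ f₂) :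
    IntegrableOn (fun t => ‖f t‖ ^ 2) (Icc 0 L) :=
  (hf.continuousOn.norm.pow 2).integrableOn_compact isCompact_Icc

theorem integrableOn_normSq_snd (hf : IsSobolevTwo L f f₁ f₂) :
    IntegrableOn (fun t => ‖f₁ t‖ ^ 2) (Icc 0 L) :=
  (hf.continuousOn_snd.norm.pow 2).integrableOn_compact isCompact_Icc

theorem normSq_sub_normSq (hf : IsSobolevTwo L f f₁ f₂) {x y : ℝ} (hx : x ∈ Icc 0 L)
    (hy : y ∈ Icc 0 L) :
    ((‖f y‖ ^ 2 - ‖f x‖ ^ 2 : ℝ) : ℂ) = ∫ t in x..y, (star (f₁ t) * f t + star (f t) * f₁ t) := by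
  have hsub : uIcc x y ⊆ Icc 0 L := ordConnected_Icc.uIcc_subset hx hy
  have h₁ : IntervalIntegrable f₁ volume x y :=
    (hf.continuousOn_snd.mono hsub).intervalIntegrable
  have h₁' : IntervalIntegrable (fun t => star (f₁ t)) volume x y :=
    (hf.conj.continuousOn_snd.mono hsub).intervalIntegrable
  rw [integral_mul_add_mul_eq_sub h₁' h₁ (fun z hz => hf.conj.fst_eq_add_integral hx (hsub hz))
    (fun z hz => hf.fst_eq_add_integral hx (hsub hz))]
  simp [Complex.conj_mul']

theorem normSq_le (hf : IsSobolevTwo L f f₁ f₂) {ε : ℝ} (hε : 0 < ε)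
    {x y : ℝ} (hx : x ∈ Icc 0 L) (hy : y ∈ Icc 0 L) :
    ‖f y‖ ^ 2 ≤ ‖f x‖ ^ 2 +
      (ε⁻¹ * (∫ t in Icc 0 L, ‖f t‖ ^ 2) + ε * ∫ t in Icc 0 L, ‖f₁ t‖ ^ 2) := by
  have hsub : uIoc x y ⊆ Icc 0 L :=
    uIoc_subset_uIcc.trans (ordConnected_Icc.uIcc_subset hx hy)
  have i : IntegrableOn (fun t => ε⁻¹ * ‖f t‖ ^ 2 + ε * ‖f₁ t‖ ^ 2) (Icc 0 L) :=
    (hf.integrableOn_normSq.const_mul _).add (hf.integrableOn_normSq_snd.const_mul _)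
  have hamgm (t : ℝ) : ‖star (f₁ t) * f t + star (f t) * f₁ t‖ ≤
      ε⁻¹ * ‖f t‖ ^ 2 + ε * ‖f₁ t‖ ^ 2 := by
    have h : 0 ≤ ε⁻¹ * (‖f t‖ - ε * ‖f₁ t‖) ^ 2 := by positivity
    have e : ε⁻¹ * (‖f t‖ - ε * ‖f₁ t‖) ^ 2 =
        ε⁻¹ * ‖f t‖ ^ 2 + ε * ‖f₁ t‖ ^ 2 - 2 * ‖f t‖ * ‖f₁ t‖ := by field_simp; ring
    refine (norm_add_le _ _).trans ?_
    simp only [norm_mul, norm_star]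
    linarith
  have hle : ‖f y‖ ^ 2 - ‖f x‖ ^ 2 ≤ ∫ t in Icc 0 L, (ε⁻¹ * ‖f t‖ ^ 2 + ε * ‖f₁ t‖ ^ 2) :=
    calc ‖f y‖ ^ 2 - ‖f x‖ ^ 2
        ≤ ‖∫ t in x..y, (star (f₁ t) * f t + star (f t) * f₁ t)‖ := by
          rw [← hf.normSq_sub_normSq hx hy, Complex.norm_real]
          exact le_abs_self _
      _ ≤ ∫ t in uIoc x y, ‖star (f₁ t) * f t + star (f t) * f₁ t‖ :=
          intervalIntegral.norm_integral_le_integral_norm_uIoc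
      _ ≤ ∫ t in uIoc x y, (ε⁻¹ * ‖f t‖ ^ 2 + ε * ‖f₁ t‖ ^ 2) :=
          integral_mono_of_nonneg (.of_forall fun _ => norm_nonneg _) (i.mono_set hsub)
            (.of_forall hamgm)
      _ ≤ ∫ t in Icc 0 L, (ε⁻¹ * ‖f t‖ ^ 2 + ε * ‖f₁ t‖ ^ 2) :=
          setIntegral_mono_set i (.of_forall fun _ => by positivity) hsub.eventuallyLE
  rw [integral_add (hf.integrableOn_normSq.const_mul _) (hf.integrableOn_normSq_snd.const_mul _),
    integral_const_mul, integral_const_mul] at hle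
  linarith

theorem trace_le (hL : 0 < L) (hf : IsSobolevTwo L f f₁ f₂) {ε : ℝ} (hε : 0 < ε)
    {y : ℝ} (hy : y ∈ Icc 0 L) :
    ‖f y‖ ^ 2 ≤ (L⁻¹ + ε⁻¹) * (∫ t in Icc 0 L, ‖f t‖ ^ 2) + ε * ∫ t in Icc 0 L, ‖f₁ t‖ ^ 2 := by
  set B := ε⁻¹ * (∫ t in Icc 0 L, ‖f t‖ ^ 2) + ε * ∫ t in Icc 0 L, ‖f₁ t‖ ^ 2
  have haverage : ∫ _ in Icc 0 L, (‖f y‖ ^ 2 - B) ≤ ∫ t in Icc 0 L, ‖f t‖ ^ 2 :=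
    setIntegral_mono_on (integrableOn_const (by simp)) hf.integrableOn_normSq measurableSet_Icc
      fun x hx => by linarith [hf.normSq_le hε hx hy]
  rw [setIntegral_const, Real.volume_real_Icc_of_le hL.le, sub_zero, smul_eq_mul] at haverage
  have hdiv := (le_inv_mul_iff₀ hL).2 haverage
  rw [add_mul]
  linarith

end IsSobolevTwo

/-! ### Piecewise continuous potentials -/

section Potential

theorem exists_bound_of_tendsto {q : ℝ → ℝ} {F : Filter ℝ} {l : ℝ} (h : Tendsto q F (𝓝 l)) :
    ∃ B, ∀ᶠ y in F, |q y| ≤ B :=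
  ⟨|l| + 1, h.abs.eventually (ge_mem_nhds (by linarith))⟩

namespace PiecewiseContinuousOn

variable {q : ℝ → ℝ} {a b : ℝ}

theorem exists_eventually_bound (h : PiecewiseContinuousOn q a b) {x : ℝ} (hx : x ∈ Icc a b) :
    ∃ B, ∀ᶠ y in 𝓝[Icc a b] x, |q y| ≤ B := by
  have hr : ∃ B, ∀ᶠ y in 𝓝[>] x, y ∈ Icc a b → |q y| ≤ B := by
    rcases hx.2.eq_or_lt with rfl | hlt
    · exact ⟨0, eventually_mem_nhdsWithin.mono fun y hy hy' => absurd hy'.2 (not_le.2 hy)⟩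
    · obtain ⟨l, hl⟩ := h.2.1 x ⟨hx.1, hlt⟩
      exact (exists_bound_of_tendsto hl).imp fun B hB => hB.mono fun y hy _ => hy
  have hl : ∃ B, ∀ᶠ y in 𝓝[<] x, y ∈ Icc a b → |q y| ≤ B := by
    rcases hx.1.eq_or_lt with rfl | hlt
    · exact ⟨0, eventually_mem_nhdsWithin.mono fun y hy hy' => absurd hy'.1 (not_le.2 hy)⟩
    · obtain ⟨l, hl⟩ := h.2.2 x ⟨hlt, hx.2⟩
      exact (exists_bound_of_tendsto hl).imp fun B hB => hB.mono fun y hy _ => hy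
  obtain ⟨B₁, h₁⟩ := hr
  obtain ⟨B₂, h₂⟩ := hl
  refine ⟨max (max B₁ B₂) |q x|, ?_⟩
  rw [eventually_nhdsWithin_iff] at h₁ h₂ ⊢
  filter_upwards [h₁, h₂] with y hy₁ hy₂ hy
  rcases lt_trichotomy y x with h | rfl | h
  · exact (hy₂ h hy).trans ((le_max_right _ _).trans (le_max_left _ _))
  · exact le_max_right _ _
  · exact (hy₁ h hy).trans ((le_max_left _ _).trans (le_max_left _ _))

theorem exists_bound (h : PiecewiseContinuousOn q a b) : ∃ B, ∀ x ∈ Icc a b, |q x| ≤ B := by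
  refine isCompact_Icc.induction_on (p := fun s => ∃ B, ∀ x ∈ s, |q x| ≤ B) ⟨0, by simp⟩ ?_ ?_ ?_
  · rintro s t hst ⟨B, hB⟩
    exact ⟨B, fun x hx => hB x (hst hx)⟩
  · rintro s t ⟨B, hB⟩ ⟨B', hB'⟩
    exact ⟨max B B', fun x hx =>
      hx.elim (fun hx => (hB x hx).trans (le_max_left _ _))
        fun hx => (hB' x hx).trans (le_max_right _ _)⟩
  · intro x hx
    obtain ⟨B, hB⟩ := h.exists_eventually_bound hx
    exact ⟨_, hB, B, fun _ hy => hy⟩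

theorem aestronglyMeasurable (h : PiecewiseContinuousOn q a b) :
    AEStronglyMeasurable q (volume.restrict (Icc a b)) := by
  obtain ⟨S, hS, hc⟩ := h.1
  have hnull := sdiff_null_ae_eq_self (s := Icc a b) (hS.measure_zero (volume : Measure ℝ))
  rw [← Measure.restrict_congr_set hnull]
  exact hc.aestronglyMeasurable (measurableSet_Icc.diff hS.measurableSet)

end PiecewiseContinuousOn

/-- A potential on the edge `[0, L]` whose multiplication operator is bounded on `L²(0, L)`. It is
bounded everywhere, not only almost everywhere, so that it can be estimated pointwise. -/
def IsBoundedPotential (q : ℝ → ℝ) (L : ℝ) : Prop :=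
  AEStronglyMeasurable q (volume.restrict (Icc 0 L)) ∧ ∃ B, ∀ x ∈ Icc 0 L, |q x| ≤ B

theorem PiecewiseContinuousOn.isBoundedPotential {q : ℝ → ℝ} {L : ℝ}
    (h : PiecewiseContinuousOn q 0 L) : IsBoundedPotential q L :=
  ⟨h.aestronglyMeasurable, h.exists_bound⟩

theorem IsBoundedPotential.comp_const_add {q : ℝ → ℝ} {L p : ℝ} (h : IsBoundedPotential q L)
    (hp : 0 ≤ p) : IsBoundedPotential (fun x => q (p + x)) (L - p) := by
  obtain ⟨hm, B, hB⟩ := h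
  have hsub : ∀ x ∈ Icc 0 (L - p), p + x ∈ Icc 0 L := fun x hx =>
    ⟨by linarith [hx.1], by linarith [hx.2]⟩
  have hres := (measurePreserving_add_left (volume : Measure ℝ) p).restrict_preimage_emb
    (measurableEmbedding_addLeft p) (Icc 0 L)
  exact ⟨(hm.comp_measurePreserving hres).mono_measure (Measure.restrict_mono hsub le_rfl), B,
    fun x hx => hB _ (hsub x hx)⟩

theorem IsBoundedPotential.mono {q : ℝ → ℝ} {L L' : ℝ} (h : IsBoundedPotential q L)
    (hL : L' ≤ L) : IsBoundedPotential q L' :=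
  have hsub : Icc 0 L' ⊆ Icc 0 L := Icc_subset_Icc_right hL
  ⟨h.1.mono_measure (Measure.restrict_mono hsub le_rfl), h.2.imp fun _ hB x hx => hB x (hsub hx)⟩

variable {V E : Type*} [Fintype V] [Fintype E]

theorem isBoundedPotential_treePotential (Γ : QuantumGraph V E) (c : Cut Γ.toMetricGraph)
    (e : TreeEdge c) : IsBoundedPotential (treePotential Γ c e) ((cutTree c).length e) := by
  rcases e with e | ⟨j, _ | _⟩
  · exact (Γ.q_pc e.1).isBoundedPotential
  · exact (Γ.q_pc (c.edge j)).isBoundedPotential.mono (c.pos_mem j).2.le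
  · exact (Γ.q_pc (c.edge j)).isBoundedPotential.comp_const_add (c.pos_mem j).1.le

end Potential

/-! ### The quadratic form of `H^α` -/

namespace MetricGraph

section VertexSum

variable {V E M : Type*} [Fintype E] (G : MetricGraph V E)

open Classical in
/-- The sum of `F` over the edge ends at the vertex `v`; a loop at `v` contributes two terms. -/
def vertexSum [AddCommMonoid M] (F : E × Bool → M) (v : V) : M :=
  ∑ h : E × Bool, if G.endpoint h.1 h.2 = v then F h else 0

theorem sum_vertexSum [Fintype V] [AddCommMonoid M] (F : E × Bool → M) :
    ∑ v, G.vertexSum F v = ∑ h, F h := by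
  classical
  simp only [vertexSum]
  rw [Finset.sum_comm]
  exact Finset.sum_congr rfl fun h _ => Fintype.sum_ite_eq _ _

theorem le_vertexSum {F : E × Bool → ℝ} (hF : ∀ h, 0 ≤ F h) {v : V} {h : E × Bool}
    (hh : G.endpoint h.1 h.2 = v) : F h ≤ G.vertexSum F v := by
  classical
  calc F h = if G.endpoint h.1 h.2 = v then F h else 0 := (if_pos hh).symm
    _ ≤ G.vertexSum F v := Finset.single_le_sum
        (f := fun h : E × Bool => if G.endpoint h.1 h.2 = v then F h else 0)
        (fun h _ => by split_ifs <;> simp [hF]) (Finset.mem_univ h)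

theorem vertexSum_eq_zero [AddCommMonoid M] {F : E × Bool → M} {v : V}
    (hv : ∀ h : E × Bool, G.endpoint h.1 h.2 ≠ v) : G.vertexSum F v = 0 :=
  Finset.sum_eq_zero fun h _ => if_neg (hv h)

theorem vertexSum_mul [NonUnitalNonAssocSemiring M] {F k : E × Bool → M} {v : V} {b : M}
    (hk : ∀ h : E × Bool, G.endpoint h.1 h.2 = v → k h = b) :
    G.vertexSum (fun h => k h * F h) v = b * G.vertexSum F v := by
  rw [vertexSum, vertexSum, Finset.mul_sum]
  refine Finset.sum_congr rfl fun h _ => ?_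
  split_ifs with hh
  · rw [hk h hh]
  · rw [mul_zero]

end VertexSum

variable {V E : Type*} [Fintype E] (G : MetricGraph V E)

/-- The boundary terms of Green's identity on the graph, for a function with derivative `f₁` and a
test function `g`. -/
def boundaryForm (f₁ g : E → ℝ → ℂ) : ℂ :=
  ∑ h : E × Bool, star (G.endValue g h.1 h.2) * G.endDeriv f₁ h.1 h.2

/-- The contribution of the vertex `v` to the boundary form. -/
def vertexForm (f₁ g : E → ℝ → ℂ) (v : V) : ℂ :=
  G.vertexSum (fun h => star (G.endValue g h.1 h.2) * G.endDeriv f₁ h.1 h.2) v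

theorem boundaryForm_eq_sum_edges (f₁ g : E → ℝ → ℂ) :
    G.boundaryForm f₁ g =
      ∑ e, (star (g e 0) * f₁ e 0 + star (g e (G.length e)) * -f₁ e (G.length e)) := by
  rw [boundaryForm, Fintype.sum_prod_type]
  refine Finset.sum_congr rfl fun e _ => ?_
  rw [Fintype.sum_bool, add_comm]
  rfl

variable {G} {f f₁ g g₁ : E → ℝ → ℂ} {v : V} {χ : WithTop ℝ}

theorem vertexForm_eq {a b : ℂ} (hg : ∀ e s, G.endpoint e s = v → G.endValue g e s = b)
    (hb : χ = ⊤ → b = 0)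
    (hf : ∀ r : ℝ, χ = (r : WithTop ℝ) →
      G.vertexSum (fun h => G.endDeriv f₁ h.1 h.2) v = r * a) :
    G.vertexForm f₁ g v = (χ.untopD 0 : ℝ) * (star b * a) := by
  rw [vertexForm, G.vertexSum_mul (b := star b) fun h hh => by rw [hg _ _ hh]]
  cases χ with
  | top => simp [hb rfl]
  | coe r =>
    rw [hf r rfl, WithTop.untopD_coe]
    ring

theorem DeltaCondition.star_vertexForm (hf : G.DeltaCondition f f₁ v χ)
    (hg : G.DeltaCondition g g₁ v χ) : star (G.vertexForm g₁ f v) = G.vertexForm f₁ g v := by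
  obtain ⟨a, ha, ha', hfa⟩ := hf
  obtain ⟨b, hb, hb', hgb⟩ := hg
  rw [vertexForm_eq hb hb' hfa, vertexForm_eq ha ha' hgb]
  simp only [star_mul', Complex.star_def, Complex.conj_ofReal, Complex.conj_conj]
  ring

theorem DeltaCondition.neg_le_re_vertexForm (hf : G.DeltaCondition f f₁ v χ) {X : ℝ}
    (hX : |χ.untopD 0| ≤ X) :
    -(X * G.vertexSum (fun h => ‖G.endValue f h.1 h.2‖ ^ 2) v) ≤ (G.vertexForm f₁ f v).re := by
  have hX0 : 0 ≤ X := (abs_nonneg _).trans hX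
  by_cases! hv : ∃ h : E × Bool, G.endpoint h.1 h.2 = v
  · obtain ⟨h₀, hh₀⟩ := hv
    obtain ⟨a, ha, ha', hfa⟩ := hf
    have hsum : ‖a‖ ^ 2 ≤ G.vertexSum (fun h => ‖G.endValue f h.1 h.2‖ ^ 2) v := by
      rw [← ha _ _ hh₀]
      exact G.le_vertexSum (fun h => sq_nonneg ‖G.endValue f h.1 h.2‖) hh₀
    rw [vertexForm_eq ha ha' hfa, Complex.re_ofReal_mul, Complex.star_def, Complex.conj_mul',
      ← Complex.ofReal_pow, Complex.ofReal_re]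
    have h1 := mul_le_mul_of_nonneg_left hsum hX0
    have h2 := mul_le_mul_of_nonneg_right (abs_le.1 hX).1 (sq_nonneg ‖a‖)
    linarith
  · rw [vertexForm, G.vertexSum_eq_zero hv, G.vertexSum_eq_zero hv]
    simp

end MetricGraph

section Boundary

variable {V E : Type*} [Fintype V] [Fintype E] {Γ : QuantumGraph V E} {c : Cut Γ.toMetricGraph}

theorem vertexSum_inr {M : Type*} [AddCommMonoid M] (F : TreeEdge c × Bool → M)
    (j : Fin Γ.betti) (b : Bool) :
    (cutTree c).vertexSum F (Sum.inr (j, b)) = F (Sum.inr (j, b), !b) := by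
  rw [MetricGraph.vertexSum, Finset.sum_eq_single (Sum.inr (j, b), !b)]
  · rw [if_pos]
    cases b <;> rfl
  · rintro ⟨e | ⟨i, _ | _⟩, _ | _⟩ - hne <;> rw [if_neg] <;>
      simp only [cutTree, reduceCtorEq, not_false_eq_true, Sum.inr.injEq]
    · rintro h
      cases h
      exact hne rfl
    · rintro h
      cases h
      exact hne rfl
  · simp

theorem sum_ends_eq_sum_vertices {M : Type*} [AddCommMonoid M] (F : TreeEdge c × Bool → M) :
    ∑ h, F h = (∑ v : V, (cutTree c).vertexSum F (Sum.inl v)) +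
      ∑ j, (F (Sum.inr (j, false), true) + F (Sum.inr (j, true), false)) := by
  rw [← (cutTree c).sum_vertexSum F, Fintype.sum_sum_type]
  congr 1
  rw [Fintype.sum_prod_type]
  refine Finset.sum_congr rfl fun j _ => ?_
  rw [Fintype.sum_bool, vertexSum_inr, vertexSum_inr, add_comm]
  rfl

variable {α : Fin Γ.betti → ℝ} {f f₁ g g₁ : TreeEdge c → ℝ → ℂ}

namespace VertexConditions

theorem boundaryForm_eq (hf : VertexConditions Γ c α f f₁) (hg : VertexConditions Γ c α g g₁) :
    (cutTree c).boundaryForm f₁ g = ∑ v, (cutTree c).vertexForm f₁ g (Sum.inl v) := by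
  rw [MetricGraph.boundaryForm, sum_ends_eq_sum_vertices]
  simp only [MetricGraph.vertexForm, add_eq_left]
  refine Finset.sum_eq_zero fun j _ => ?_
  rw [hg.jump j, hf.jump_deriv j, star_mul', Complex.star_def, ← Complex.exp_conj]
  have hphase : Complex.exp ((starRingEnd ℂ) (Complex.I * α j)) *
      Complex.exp (Complex.I * α j) = 1 := by
    rw [← Complex.exp_add]
    simp
  linear_combination (-(starRingEnd ℂ) ((cutTree c).endValue g (Sum.inr (j, false)) true) *
    (cutTree c).endDeriv f₁ (Sum.inr (j, false)) true) * hphase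

theorem star_boundaryForm (hf : VertexConditions Γ c α f f₁) (hg : VertexConditions Γ c α g g₁) :
    star ((cutTree c).boundaryForm g₁ f) = (cutTree c).boundaryForm f₁ g := by
  rw [boundaryForm_eq hf hg, boundaryForm_eq hg hf, star_sum]
  exact Finset.sum_congr rfl fun v _ => (hf.delta v).star_vertexForm (hg.delta v)

theorem neg_le_re_boundaryForm (hf : VertexConditions Γ c α f f₁) {X : ℝ}
    (hX : ∀ v, |(Γ.χ v).untopD 0| ≤ X) (hX0 : 0 ≤ X) :
    -(X * ∑ h : TreeEdge c × Bool, ‖(cutTree c).endValue f h.1 h.2‖ ^ 2) ≤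
      ((cutTree c).boundaryForm f₁ f).re := by
  rw [hf.boundaryForm_eq hf, Complex.re_sum]
  refine le_trans ?_ (Finset.sum_le_sum fun v _ => (hf.delta v).neg_le_re_vertexForm (hX v))
  rw [Finset.sum_neg_distrib, neg_le_neg_iff, ← Finset.mul_sum, sum_ends_eq_sum_vertices]
  refine mul_le_mul_of_nonneg_left (le_add_of_nonneg_right ?_) hX0
  exact Finset.sum_nonneg fun j _ => add_nonneg (sq_nonneg _) (sq_nonneg _)

end VertexConditions

end Boundary

section EdgeForm

/-- The energy form `∫ f' ḡ' + q f ḡ` of the edge `[0, L]`, for functions `f` and `g` with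
derivatives `f₁` and `g₁`. -/
def edgeForm (L : ℝ) (q : ℝ → ℝ) (f f₁ g g₁ : ℝ → ℂ) : ℂ :=
  (∫ x in Icc 0 L, star (g₁ x) * f₁ x) + ∫ x in Icc 0 L, (q x : ℂ) * (star (g x) * f x)

theorem star_edgeForm (L : ℝ) (q : ℝ → ℝ) (f f₁ g g₁ : ℝ → ℂ) :
    star (edgeForm L q g g₁ f f₁) = edgeForm L q f f₁ g g₁ := by
  simp only [edgeForm, star_add, Complex.star_def, ← integral_conj, map_mul, Complex.conj_conj,
    Complex.conj_ofReal]
  simp only [mul_comm]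

variable {L : ℝ} {q : ℝ → ℝ} {f f₁ f₂ g g₁ g₂ : ℝ → ℂ}

theorem IsBoundedPotential.integrableOn_mul (hq : IsBoundedPotential q L)
    {k : ℝ → ℂ} (hk : IntegrableOn k (Icc 0 L)) :
    IntegrableOn (fun x => (q x : ℂ) * k x) (Icc 0 L) := by
  obtain ⟨hm, B, hB⟩ := hq
  refine Integrable.bdd_mul (c := B) hk (Complex.continuous_ofReal.comp_aestronglyMeasurable hm) ?_
  filter_upwards [ae_restrict_mem measurableSet_Icc] with x hx
  simpa using hB x hx

theorem IsSobolevTwo.green_potential (hL : 0 ≤ L) (hq : IsBoundedPotential q L)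
    (hf : IsSobolevTwo L f f₁ f₂) (hg : IsSobolevTwo L g g₁ g₂) :
    ∫ x in Icc 0 L, star (g x) * (-f₂ x + (q x : ℂ) * f x) = edgeForm L q f f₁ g g₁ +
      (star (g 0) * f₁ 0 + star (g L) * -f₁ L) := by
  have hsplit : ∀ x, star (g x) * (-f₂ x + (q x : ℂ) * f x) =
      star (g x) * -f₂ x + (q x : ℂ) * (star (g x) * f x) := fun x => by ring
  simp only [hsplit]
  rw [integral_add, hf.green hL hg, edgeForm]
  · ring
  · exact hf.integrable.neg.continuousOn_mul hg.conj.continuousOn isCompact_Icc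
  · exact hq.integrableOn_mul
      ((hg.conj.continuousOn.mul hf.continuousOn).integrableOn_compact isCompact_Icc)

theorem IsSobolevTwo.re_edgeForm_ge (hf : IsSobolevTwo L f f₁ f₂) {B : ℝ}
    (hq : AEStronglyMeasurable q (volume.restrict (Icc 0 L))) (hB : ∀ x ∈ Icc 0 L, |q x| ≤ B) :
    (∫ x in Icc 0 L, ‖f₁ x‖ ^ 2) - B * (∫ x in Icc 0 L, ‖f x‖ ^ 2) ≤
      (edgeForm L q f f₁ f f₁).re := by
  have i : IntegrableOn (fun t => q t * ‖f t‖ ^ 2) (Icc 0 L) := by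
    refine Integrable.bdd_mul (c := B) hf.integrableOn_normSq hq ?_
    filter_upwards [ae_restrict_mem measurableSet_Icc] with x hx
    exact hB x hx
  have e1 : ∫ x in Icc 0 L, star (f₁ x) * f₁ x = ((∫ x in Icc 0 L, ‖f₁ x‖ ^ 2 : ℝ) : ℂ) := by
    rw [← integral_complex_ofReal]
    simp [Complex.conj_mul']
  have e2 : ∫ x in Icc 0 L, (q x : ℂ) * (star (f x) * f x) =
      ((∫ x in Icc 0 L, q x * ‖f x‖ ^ 2 : ℝ) : ℂ) := by
    rw [← integral_complex_ofReal]
    simp [Complex.conj_mul']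
  rw [edgeForm, e1, e2, Complex.add_re, Complex.ofReal_re, Complex.ofReal_re, sub_eq_add_neg,
    ← neg_mul, ← integral_const_mul]
  refine add_le_add_right (setIntegral_mono_on (hf.integrableOn_normSq.const_mul _) i
    measurableSet_Icc fun x hx => ?_) _
  exact mul_le_mul_of_nonneg_right (abs_le.1 (hB x hx)).1 (sq_nonneg _)

theorem IsSobolevTwo.re_edgeForm_sub_ends_ge (hf : IsSobolevTwo L f f₁ f₂) (hL : 0 < L) {B X : ℝ}
    (hq : AEStronglyMeasurable q (volume.restrict (Icc 0 L))) (hB : ∀ x ∈ Icc 0 L, |q x| ≤ B)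
    (hX : 0 ≤ X) :
    -((B + 2 * X * (L⁻¹ + (2 * X + 1))) * ∫ x in Icc 0 L, ‖f x‖ ^ 2) ≤
      (edgeForm L q f f₁ f f₁).re - X * (‖f 0‖ ^ 2 + ‖f L‖ ^ 2) := by
  have hε : 0 < (2 * X + 1)⁻¹ := by positivity
  have h0 := mul_le_mul_of_nonneg_left (hf.trace_le hL hε (left_mem_Icc.2 hL.le)) hX
  have hend := mul_le_mul_of_nonneg_left (hf.trace_le hL hε (right_mem_Icc.2 hL.le)) hX
  have hD : 0 ≤ ∫ x in Icc 0 L, ‖f₁ x‖ ^ 2 := integral_nonneg fun x => sq_nonneg _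
  have hsmall : 2 * X * (2 * X + 1)⁻¹ ≤ 1 := by
    rw [← div_eq_mul_inv, div_le_one (by positivity)]
    linarith
  have habsorb := mul_le_mul_of_nonneg_right hsmall hD
  have hform := hf.re_edgeForm_ge hq hB
  rw [inv_inv] at h0 hend
  linarith

end EdgeForm

section GraphForm

variable {V E : Type*} [Fintype E] {G : MetricGraph V E}

theorem norm_sq_eq_sum_integral {u : GraphL2 G} {f : E → ℝ → ℂ}
    (hu : ∀ e, u e =ᵐ[volume.restrict (Icc 0 (G.length e))] f e) :
    ‖u‖ ^ 2 = ∑ e, ∫ x in Icc 0 (G.length e), ‖f e x‖ ^ 2 := by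
  rw [PiLp.norm_sq_eq_of_L2]
  refine Finset.sum_congr rfl fun e _ => ?_
  have hinner : (inner ℂ (u e) (u e) : ℂ) =
      ((∫ x in Icc 0 (G.length e), ‖f e x‖ ^ 2 : ℝ) : ℂ) := by
    rw [L2.inner_def, ← integral_complex_ofReal]
    refine integral_congr_ae ?_
    filter_upwards [hu e] with x hx
    rw [hx, inner_self_eq_norm_sq_to_K]
    push_cast
    rfl
  refine Complex.ofReal_injective ?_
  rw [← hinner, inner_self_eq_norm_sq_to_K]
  push_cast
  rfl

theorem inner_eq_sum_edgeForm_add_boundaryForm {q : E → ℝ → ℝ}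
    (hq : ∀ e, IsBoundedPotential (q e) (G.length e)) {f f₁ f₂ g g₁ g₂ : E → ℝ → ℂ}
    {u w : GraphL2 G} (hf : ∀ e, IsSobolevTwo (G.length e) (f e) (f₁ e) (f₂ e))
    (hg : ∀ e, IsSobolevTwo (G.length e) (g e) (g₁ e) (g₂ e))
    (hu : ∀ e, u e =ᵐ[volume.restrict (Icc 0 (G.length e))] g e)
    (hw : ∀ e, w e =ᵐ[volume.restrict (Icc 0 (G.length e))]
      fun x => -f₂ e x + (q e x : ℂ) * f e x) :
    inner ℂ u w = (∑ e, edgeForm (G.length e) (q e) (f e) (f₁ e) (g e) (g₁ e)) +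
      G.boundaryForm f₁ g := by
  rw [G.boundaryForm_eq_sum_edges, ← Finset.sum_add_distrib, PiLp.inner_apply]
  refine Finset.sum_congr rfl fun e _ => ?_
  rw [← (hf e).green_potential (G.length_pos e).le (hq e) (hg e), L2.inner_def]
  refine integral_congr_ae ?_
  filter_upwards [hu e, hw e] with x h1 h2
  rw [h1, h2, RCLike.inner_apply, mul_comm]
  rfl

variable (G) in
theorem exists_sum_edgeForm_lowerBound {q : E → ℝ → ℝ}
    (hq : ∀ e, IsBoundedPotential (q e) (G.length e)) {X : ℝ} (hX : 0 ≤ X) :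
    ∃ K : ℝ, ∀ f f₁ f₂ : E → ℝ → ℂ,
      (∀ e, IsSobolevTwo (G.length e) (f e) (f₁ e) (f₂ e)) →
      -(K * ∑ e, ∫ x in Icc 0 (G.length e), ‖f e x‖ ^ 2) ≤
        (∑ e, edgeForm (G.length e) (q e) (f e) (f₁ e) (f e) (f₁ e)).re -
          X * ∑ h : E × Bool, ‖G.endValue f h.1 h.2‖ ^ 2 := by
  choose hm B hB using hq
  have hB0 : ∀ e, 0 ≤ B e := fun e =>
    (abs_nonneg _).trans (hB e 0 (left_mem_Icc.2 (G.length_pos e).le))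
  let k : E → ℝ := fun e => B e + 2 * X * ((G.length e)⁻¹ + (2 * X + 1))
  have hk0 : ∀ e, 0 ≤ k e := fun e => by
    have := hB0 e
    have := G.length_pos e
    positivity
  refine ⟨∑ e, k e, fun f f₁ f₂ hf => ?_⟩
  rw [Complex.re_sum, Fintype.sum_prod_type, Finset.mul_sum, Finset.mul_sum,
    ← Finset.sum_sub_distrib, ← Finset.sum_neg_distrib]
  refine Finset.sum_le_sum fun e _ => ?_
  have hk : k e ≤ ∑ e, k e := Finset.single_le_sum (fun e _ => hk0 e) (Finset.mem_univ e)
  have hN : 0 ≤ ∫ x in Icc 0 (G.length e), ‖f e x‖ ^ 2 := integral_nonneg fun x => sq_nonneg _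
  have hedge := (hf e).re_edgeForm_sub_ends_ge (G.length_pos e) (hm e) (hB e) hX
  rw [Fintype.sum_bool, add_comm (‖G.endValue f e true‖ ^ 2)]
  exact (neg_le_neg (mul_le_mul_of_nonneg_right hk hN)).trans hedge

end GraphForm

section MagneticForm

variable {V E : Type*} [Fintype V] [Fintype E]

theorem InGraph.inner_comm {Γ : QuantumGraph V E} {c : Cut Γ.toMetricGraph} {α : Fin Γ.betti → ℝ}
    {u w u' w' : GraphL2 (cutTree c)} (h : InGraph Γ c α u w) (h' : InGraph Γ c α u' w') :
    inner ℂ w u' = inner ℂ u w' := by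
  obtain ⟨f, f₁, f₂, hS, hV, hu, hw⟩ := h
  obtain ⟨g, g₁, g₂, hS', hV', hu', hw'⟩ := h'
  have hq := isBoundedPotential_treePotential Γ c
  rw [← inner_conj_symm, inner_eq_sum_edgeForm_add_boundaryForm hq hS hS' hu' hw,
    inner_eq_sum_edgeForm_add_boundaryForm hq hS' hS hu hw', ← Complex.star_def, star_add,
    star_sum, hV'.star_boundaryForm hV]
  simp only [star_edgeForm]

theorem exists_lowerBound (Γ : QuantumGraph V E) (c : Cut Γ.toMetricGraph) :
    ∃ K : ℝ, ∀ (α : Fin Γ.betti → ℝ) (u w : GraphL2 (cutTree c)), InGraph Γ c α u w →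
      -(K * ‖u‖ ^ 2) ≤ (inner ℂ u w).re := by
  have hq := isBoundedPotential_treePotential Γ c
  have hX0 : 0 ≤ ∑ v, |(Γ.χ v).untopD 0| := Finset.sum_nonneg fun v _ => abs_nonneg _
  have hX : ∀ v, |(Γ.χ v).untopD 0| ≤ ∑ v, |(Γ.χ v).untopD 0| := fun v =>
    Finset.single_le_sum (f := fun v => |(Γ.χ v).untopD 0|) (fun v _ => abs_nonneg _)
      (Finset.mem_univ v)
  obtain ⟨K, hform⟩ := exists_sum_edgeForm_lowerBound (cutTree c) hq hX0
  refine ⟨K, fun α u w h => ?_⟩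
  obtain ⟨f, f₁, f₂, hS, hV, hu, hw⟩ := h
  rw [inner_eq_sum_edgeForm_add_boundaryForm hq hS hS hu hw, Complex.add_re,
    norm_sq_eq_sum_integral hu]
  linarith [hform f f₁ f₂ hS, hV.neg_le_re_boundaryForm hX hX0]

end MagneticForm

/-! ### Operators on an edge -/

section Edge

variable {L : ℝ}

theorem integrableOn_edge (w : EdgeL2 L) : IntegrableOn w (Icc 0 L) :=
  (Lp.memLp w).integrable (by norm_num)

theorem intervalIntegrable_edge (w : EdgeL2 L) {x y : ℝ} (hx : x ∈ Icc 0 L) (hy : y ∈ Icc 0 L) :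
    IntervalIntegrable w volume x y :=
  intervalIntegrable_iff.2 <| (integrableOn_edge w).mono_set <|
    uIoc_subset_uIcc.trans <| ordConnected_Icc.uIcc_subset hx hy

variable (L) in
/-- The indicator function of `(x, y]` in `L²(0, L)`. -/
def edgeIndicator (x y : ℝ) : EdgeL2 L :=
  indicatorConstLp 2 measurableSet_Ioc (measure_ne_top _ (Ioc x y)) (1 : ℂ)

section Interval

variable {x y : ℝ} (hx : x ∈ Icc 0 L) (hy : y ∈ Icc 0 L)
include hx hy

theorem Ioc_subset_edge : Ioc x y ⊆ Icc 0 L :=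
  fun _ ht => ⟨hx.1.trans ht.1.le, ht.2.trans hy.2⟩

theorem norm_edgeIndicator (hxy : x ≤ y) : ‖edgeIndicator L x y‖ = √(y - x) := by
  rw [edgeIndicator, norm_indicatorConstLp (by norm_num) (by norm_num), measureReal_restrict_apply
    measurableSet_Ioc, inter_eq_self_of_subset_left (Ioc_subset_edge hx hy),
    Real.volume_real_Ioc_of_le hxy, norm_one, one_mul, Real.sqrt_eq_rpow]
  norm_num

theorem inner_edgeIndicator (hxy : x ≤ y) (w : EdgeL2 L) :
    inner ℂ (edgeIndicator L x y) w = ∫ t in x..y, w t := by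
  rw [edgeIndicator, L2.inner_indicatorConstLp_one, intervalIntegral.integral_of_le hxy,
    Measure.restrict_restrict measurableSet_Ioc,
    inter_eq_self_of_subset_left (Ioc_subset_edge hx hy)]

theorem norm_integral_edge_le (hxy : x ≤ y) (w : EdgeL2 L) :
    ‖∫ t in x..y, w t‖ ≤ √(y - x) * ‖w‖ := by
  rw [← inner_edgeIndicator hx hy hxy, ← norm_edgeIndicator hx hy hxy]
  exact norm_inner_le_norm _ _

theorem norm_integral_sub_edge_le (w : EdgeL2 L) :
    ‖(∫ t in (0 : ℝ)..y, w t) - ∫ t in (0 : ℝ)..x, w t‖ ≤ √|y - x| * ‖w‖ := by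
  have h0 : (0 : ℝ) ∈ Icc 0 L := left_mem_Icc.2 (hx.1.trans hx.2)
  rw [intervalIntegral.integral_interval_sub_left (intervalIntegrable_edge w h0 hy)
    (intervalIntegrable_edge w h0 hx)]
  rcases le_total x y with h | h
  · rw [abs_of_nonneg (sub_nonneg.2 h)]
    exact norm_integral_edge_le hx hy h w
  · rw [abs_of_nonpos (sub_nonpos.2 h), neg_sub, intervalIntegral.integral_symm, norm_neg]
    exact norm_integral_edge_le hy hx h w

end Interval

theorem not_finiteDimensional_edgeL2 (hL : 0 < L) : ¬ FiniteDimensional ℂ (EdgeL2 L) := by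
  intro hfd
  let p : ℕ → ℝ := fun k => L / (k + 1)
  have hp : StrictAnti p := fun i j hij =>
    div_lt_div_of_pos_left hL (by positivity) (by exact_mod_cast Nat.succ_lt_succ hij)
  have hmem (k : ℕ) : p k ∈ Icc 0 L :=
    ⟨by positivity, div_le_self hL.le (by linarith [k.cast_nonneg (α := ℝ)])⟩
  have hli : LinearIndependent ℂ fun k => edgeIndicator L (p (k + 1)) (p k) := by
    refine linearIndependent_of_ne_zero_of_inner_eq_zero (fun k => ?_) fun i j hij => ?_
    · rw [← norm_pos_iff, norm_edgeIndicator (hmem _) (hmem _) (hp k.lt_succ_self).le,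
        Real.sqrt_pos, sub_pos]
      exact hp k.lt_succ_self
    · have hdisj : Disjoint (Ioc (p (i + 1)) (p i)) (Ioc (p (j + 1)) (p j)) :=
        hp.antitone.pairwise_disjoint_on_Ioc_succ hij
      simp only [edgeIndicator, L2.inner_indicatorConstLp_indicatorConstLp, hdisj.inter_eq,
        measureReal_empty, zero_smul]
  exact not_finite_iff_infinite.2 inferInstance hli.finite

/-- The primitive of `w` that vanishes at `0`, as a continuous function. -/
def primitiveFun (w : EdgeL2 L) : C(Icc (0 : ℝ) L, ℂ) where
  toFun x := ∫ t in (0 : ℝ)..x, w t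
  continuous_toFun := by
    refine continuous_iff_continuousAt.2 fun x => tendsto_iff_norm_sub_tendsto_zero.2 ?_
    have hlim : Tendsto (fun y : Icc (0 : ℝ) L => √|(y : ℝ) - x| * ‖w‖) (𝓝 x) (𝓝 0) := by
      have hc : Continuous fun y : Icc (0 : ℝ) L => √|(y : ℝ) - x| * ‖w‖ := by fun_prop
      simpa using hc.tendsto x
    exact squeeze_zero (fun _ => norm_nonneg _)
      (fun y => norm_integral_sub_edge_le x.2 y.2 w) hlim

theorem primitiveFun_eq_inner (w : EdgeL2 L) (x : Icc (0 : ℝ) L) :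
    primitiveFun w x = inner ℂ (edgeIndicator L 0 x) w :=
  (inner_edgeIndicator (left_mem_Icc.2 (x.2.1.trans x.2.2)) x.2 x.2.1 w).symm

theorem norm_primitiveFun_le (w : EdgeL2 L) : ‖primitiveFun w‖ ≤ √L * ‖w‖ := by
  refine (ContinuousMap.norm_le _ (by positivity)).2 fun x => ?_
  refine (norm_integral_edge_le (left_mem_Icc.2 (x.2.1.trans x.2.2)) x.2 x.2.1 w).trans ?_
  gcongr
  rw [sub_zero]
  exact x.2.2

variable (L) in
/-- The Volterra operator `w ↦ ∫₀ˣ w`. -/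
def primitive : EdgeL2 L →L[ℂ] C(Icc (0 : ℝ) L, ℂ) :=
  LinearMap.mkContinuous
    { toFun := primitiveFun
      map_add' := fun w w' => ContinuousMap.ext fun x => by
        simp only [primitiveFun_eq_inner, ContinuousMap.add_apply, inner_add_right]
      map_smul' := fun z w => ContinuousMap.ext fun x => by
        simp only [primitiveFun_eq_inner, ContinuousMap.smul_apply, inner_smul_right,
          RingHom.id_apply, smul_eq_mul] }
    (√L) norm_primitiveFun_le

theorem primitive_apply (w : EdgeL2 L) (x : Icc (0 : ℝ) L) :
    primitive L w x = ∫ t in (0 : ℝ)..x, w t := rfl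

theorem isCompactOperator_primitive : IsCompactOperator (primitive L) := by
  let Φ := ContinuousMap.linearIsometryBoundedOfCompact (Icc (0 : ℝ) L) ℂ ℂ
  let T : EdgeL2 L →L[ℂ] BoundedContinuousFunction (Icc (0 : ℝ) L) ℂ :=
    (Φ.toContinuousLinearEquiv : C(Icc (0 : ℝ) L, ℂ) →L[ℂ] _).comp (primitive L)
  have hT : IsCompactOperator T := by
    refine (isCompactOperator_iff_isCompact_closure_image_closedBall
      (T : EdgeL2 L →ₗ[ℂ] BoundedContinuousFunction (Icc (0 : ℝ) L) ℂ) one_pos).2 ?_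
    refine BoundedContinuousFunction.arzela_ascoli (Metric.closedBall (0 : ℂ) √L)
      (isCompact_closedBall _ _) _ ?_ ?_
    · rintro _ x ⟨w, hw, rfl⟩
      rw [mem_closedBall_zero_iff] at hw ⊢
      exact ((primitive L w).norm_coe_le_norm x).trans <|
        (norm_primitiveFun_le w).trans <| mul_le_of_le_one_right (Real.sqrt_nonneg _) hw
    · refine Metric.equicontinuous_of_continuity_modulus (fun d => √d) ?_ _ ?_
      · simpa using Real.continuous_sqrt.tendsto 0
      · rintro x y ⟨_, w, hw, rfl⟩
        rw [mem_closedBall_zero_iff] at hw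
        rw [dist_comm, dist_comm x y, dist_eq_norm, Subtype.dist_eq, Real.dist_eq]
        exact (norm_integral_sub_edge_le x.2 y.2 w).trans
          (mul_le_of_le_one_right (Real.sqrt_nonneg _) hw)
  exact hT.clm_comp (Φ.symm.toContinuousLinearEquiv :
    BoundedContinuousFunction (Icc (0 : ℝ) L) ℂ →L[ℂ] C(Icc (0 : ℝ) L, ℂ))

theorem memLp_IccExtend (hL : 0 ≤ L) (g : C(Icc (0 : ℝ) L, ℂ)) :
    MemLp (IccExtend hL g) 2 (volume.restrict (Icc 0 L)) :=
  MemLp.of_bound (g.continuous.Icc_extend' (h := hL)).aestronglyMeasurable ‖g‖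
    (Eventually.of_forall fun _ => g.norm_coe_le_norm _)

/-- The inclusion of `C([0, L])` in `L²(0, L)`. -/
def toEdgeL2 (hL : 0 ≤ L) : C(Icc (0 : ℝ) L, ℂ) →L[ℂ] EdgeL2 L :=
  LinearMap.mkContinuous
    { toFun := fun g => (memLp_IccExtend hL g).toLp
      map_add' := fun g g' => MemLp.toLp_add (memLp_IccExtend hL g) (memLp_IccExtend hL g')
      map_smul' := fun z g => MemLp.toLp_const_smul z (memLp_IccExtend hL g) }
    (measureUnivNNReal (volume.restrict (Icc (0 : ℝ) L)) ^ (2 : ENNReal).toReal⁻¹) fun g => by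
      refine Lp.norm_le_of_ae_bound (norm_nonneg g) ?_
      filter_upwards [(memLp_IccExtend hL g).coeFn_toLp] with x hx
      exact (congrArg norm hx).trans_le (g.norm_coe_le_norm _)

theorem coeFn_toEdgeL2 (hL : 0 ≤ L) (g : C(Icc (0 : ℝ) L, ℂ)) :
    toEdgeL2 hL g =ᵐ[volume.restrict (Icc 0 L)] IccExtend hL g :=
  (memLp_IccExtend hL g).coeFn_toLp

theorem integral_toEdgeL2 (hL : 0 ≤ L) (g : C(Icc (0 : ℝ) L, ℂ)) {x : ℝ} (hx : x ∈ Icc 0 L) :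
    ∫ t in (0 : ℝ)..x, toEdgeL2 hL g t = ∫ t in (0 : ℝ)..x, IccExtend hL g t := by
  refine intervalIntegral.integral_congr_ae_restrict
    (ae_restrict_of_ae_restrict_of_subset ?_ (coeFn_toEdgeL2 hL g))
  exact uIoc_subset_uIcc.trans (ordConnected_Icc.uIcc_subset (left_mem_Icc.2 hL) hx)

theorem toEdgeL2_injective (hL : 0 < L) : Function.Injective (toEdgeL2 hL.le) := by
  refine (injective_iff_map_eq_zero _).2 fun g hg => ?_
  have hae : IccExtend hL.le g =ᵐ[volume.restrict (Icc 0 L)] fun _ => (0 : ℂ) := by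
    refine (coeFn_toEdgeL2 hL.le g).symm.trans ?_
    rw [hg]
    exact Lp.coeFn_zero _ _ _
  have hzero : EqOn (IccExtend hL.le g) (fun _ => 0) (Icc 0 L) :=
    Measure.eqOn_Icc_of_ae_eq volume hL.ne hae
      (g.continuous.Icc_extend' (h := hL.le)).continuousOn continuousOn_const
  ext x
  exact (IccExtend_of_mem _ _ x.2).symm.trans (hzero x.2)

variable {q : ℝ → ℝ}

theorem IsBoundedPotential.memLp_top (hq : IsBoundedPotential q L) :
    MemLp (fun x => (q x : ℂ)) ⊤ (volume.restrict (Icc 0 L)) := by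
  obtain ⟨hm, B, hB⟩ := hq
  refine memLp_top_of_bound (Complex.continuous_ofReal.comp_aestronglyMeasurable hm) B ?_
  filter_upwards [ae_restrict_mem measurableSet_Icc] with x hx
  exact (Complex.norm_real _).trans_le (hB x hx)

/-- Multiplication by a bounded potential. -/
def mulPotential (hq : IsBoundedPotential q L) : EdgeL2 L →L[ℂ] EdgeL2 L :=
  (ContinuousLinearMap.mul ℂ ℂ).holderL (volume.restrict (Icc 0 L)) ⊤ 2 2 hq.memLp_top.toLp

theorem coeFn_mulPotential (hq : IsBoundedPotential q L) (w : EdgeL2 L) :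
    mulPotential hq w =ᵐ[volume.restrict (Icc 0 L)] fun x => (q x : ℂ) * w x := by
  filter_upwards [(ContinuousLinearMap.mul ℂ ℂ).coeFn_holder (r := 2) hq.memLp_top.toLp w,
    hq.memLp_top.coeFn_toLp] with x hx hqx
  exact hx.trans (congrArg (· * w x) hqx)

end Edge

/-! ### The linear system for the resolvent

A function in `H²` of an edge is `a + b x - ∫₀ˣ∫₀ᵗ w` with `w = -f''`. In terms of `w` and of the
Cauchy data `(a, b)`, the equation `(H^α + K) f = g` becomes a linear system
`A (w, (a, b)) = (g, 0)`, where `A` is a compact perturbation of the identity. -/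

section Fredholm

theorem isCompactOperator_pi {X ι : Type*} {Y : ι → Type*} [Zero X] [TopologicalSpace X] [Finite ι]
    [∀ i, TopologicalSpace (Y i)] {T : X → ∀ i, Y i} (hT : ∀ i, IsCompactOperator (T · i)) :
    IsCompactOperator T := by
  choose C hC hTC using hT
  refine ⟨univ.pi C, isCompact_univ_pi hC, ?_⟩
  filter_upwards [eventually_all.2 hTC] with x hx i _ using hx i

variable {X P Y Z : Type*} [NormedAddCommGroup X] [NormedSpace ℂ X] [NormedAddCommGroup P]
  [NormedSpace ℝ P] [NormedAddCommGroup Y] [NormedSpace ℂ Y] [NormedAddCommGroup Z]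
  [NormedSpace ℂ Z]

theorem differentiable_prodCLM {S : P → X →L[ℂ] Y} {T : P → X →L[ℂ] Z}
    (hS : Differentiable ℝ S) (hT : Differentiable ℝ T) :
    Differentiable ℝ fun p => (S p).prod (T p) :=
  ((ContinuousLinearMap.prodₗᵢ ℂ : (X →L[ℂ] Y) × (X →L[ℂ] Z) ≃ₗᵢ[ℂ]
    (X →L[ℂ] Y × Z)).toContinuousLinearEquiv.toContinuousLinearMap.restrictScalars
      ℝ).differentiable.comp (hS.prodMk hT)

theorem differentiable_piCLM {ι : Type*} [Finite ι] {S : P → ι → X →L[ℂ] Y}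
    (hS : ∀ i, Differentiable ℝ (S · i)) :
    Differentiable ℝ fun p => ContinuousLinearMap.pi (S p) := by
  have := Fintype.ofFinite ι
  exact ((ContinuousLinearMap.piEquivL ℂ X fun _ : ι => Y).toContinuousLinearMap.restrictScalars
      ℝ).differentiable.comp (differentiable_pi.2 hS)

variable [CompleteSpace X]

theorem isUnit_of_isCompactOperator_sub_one {A : X →L[ℂ] X}
    (hA : IsCompactOperator (A - 1 : X →L[ℂ] X)) (hinj : Function.Injective A) : IsUnit A := by
  have hC : IsCompactOperator (1 - A : X →L[ℂ] X) := by
    rw [← neg_sub]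
    exact hA.neg
  rcases hC.hasEigenvalue_or_mem_resolventSet one_ne_zero with h | h
  · obtain ⟨x, hx⟩ := h.exists_hasEigenvector
    have hAx : A x = 0 := by simpa using hx.apply_eq_smul
    exact absurd ((injective_iff_map_eq_zero A).1 hinj x hAx) hx.2
  · simpa [spectrum.mem_resolventSet_iff] using h

theorem differentiableAt_comp_inverse_comp {A : P → X →L[ℂ] X} {p : P}
    (hA : DifferentiableAt ℝ A p) (hu : IsUnit (A p))
    (U : X →L[ℂ] Z) (J : Y →L[ℂ] X) :
    DifferentiableAt ℝ (fun p => U ∘L Ring.inverse (A p) ∘L J) p := by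
  have hinv : DifferentiableAt ℝ Ring.inverse (A p) :=
    (differentiableAt_inverse (𝕜 := ℂ) hu).restrictScalars ℝ
  let F : (X →L[ℂ] X) →L[ℂ] (Y →L[ℂ] Z) :=
    ContinuousLinearMap.compL ℂ Y X Z U ∘L (ContinuousLinearMap.compL ℂ Y X X).flip J
  exact (F.restrictScalars ℝ).differentiableAt.comp p (hinv.comp p hA)

end Fredholm

section Edge

variable {L : ℝ}

theorem IsSobolevTwo.eqOn_zero {f f₁ f₂ : ℝ → ℂ} (h : IsSobolevTwo L f f₁ f₂) (hL : 0 < L)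
    (hf : EqOn f 0 (Icc 0 L)) :
    EqOn f₁ 0 (Icc 0 L) ∧ f₂ =ᵐ[volume.restrict (Icc 0 L)] 0 := by
  have h0 : (0 : ℝ) ∈ Icc 0 L := left_mem_Icc.2 hL.le
  have hf₁ : EqOn f₁ 0 (Icc 0 L) := by
    refine Measure.eqOn_Icc_of_ae_eq volume hL.ne ?_ h.continuousOn_snd continuousOn_const
    refine ae_zero_of_primitive_zero hL (h.continuousOn_snd.integrableOn_compact isCompact_Icc)
      fun x hx => ?_
    simpa [hf hx, hf h0] using (h.fst x hx).symm
  refine ⟨hf₁, ae_zero_of_primitive_zero hL h.integrable fun x hx => ?_⟩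
  simpa [hf₁ hx, hf₁ h0] using (h.snd x hx).symm

variable (L) in
/-- The data `(-f'', f 0, f' 0)` that determine a function `f` in the Sobolev space `H²(0, L)`. -/
abbrev EdgeData : Type := EdgeL2 L × ℂ × ℂ

variable (L) in
/-- The derivative of the function with given data. -/
def edgeDeriv : EdgeData L →L[ℂ] C(Icc (0 : ℝ) L, ℂ) :=
  (ContinuousLinearMap.snd ℂ ℂ ℂ ∘L ContinuousLinearMap.snd ℂ (EdgeL2 L) (ℂ × ℂ)).smulRight 1 -
    primitive L ∘L ContinuousLinearMap.fst ℂ (EdgeL2 L) (ℂ × ℂ)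

/-- The function with given data. -/
def edgeFun (hL : 0 ≤ L) : EdgeData L →L[ℂ] C(Icc (0 : ℝ) L, ℂ) :=
  (ContinuousLinearMap.fst ℂ ℂ ℂ ∘L ContinuousLinearMap.snd ℂ (EdgeL2 L) (ℂ × ℂ)).smulRight 1 +
    primitive L ∘L toEdgeL2 hL ∘L edgeDeriv L

theorem isCompactOperator_edgeFun (hL : 0 ≤ L) : IsCompactOperator (edgeFun hL) :=
  ((isCompactOperator_of_locallyCompactSpace_dom
    (ContinuousLinearMap.fst ℂ ℂ ℂ ∘L ContinuousLinearMap.snd ℂ (EdgeL2 L) (ℂ × ℂ))).clm_comp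
    (ContinuousLinearMap.toSpanSingleton ℂ 1)).add
    (isCompactOperator_primitive.comp_clm (toEdgeL2 hL ∘L edgeDeriv L))

theorem edgeDeriv_apply (d : EdgeData L) (x : Icc (0 : ℝ) L) :
    edgeDeriv L d x = d.2.2 - ∫ t in (0 : ℝ)..x, d.1 t := by
  simp [edgeDeriv, primitive_apply]

theorem edgeFun_apply (hL : 0 ≤ L) (d : EdgeData L) (x : Icc (0 : ℝ) L) :
    edgeFun hL d x = d.2.1 + ∫ t in (0 : ℝ)..x, IccExtend hL (edgeDeriv L d) t := by
  simp [edgeFun, primitive_apply, integral_toEdgeL2 hL _ x.2]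

theorem isSobolevTwo_edgeFun (hL : 0 ≤ L) (d : EdgeData L) :
    IsSobolevTwo L (IccExtend hL (edgeFun hL d)) (IccExtend hL (edgeDeriv L d))
      (fun t => -d.1 t) := by
  have h0 : (0 : ℝ) ∈ Icc 0 L := left_mem_Icc.2 hL
  refine ⟨(Lp.memLp d.1).neg, fun x hx => ?_, fun x hx => ?_⟩
  · rw [IccExtend_of_mem _ _ hx, IccExtend_of_mem _ _ h0, edgeDeriv_apply, edgeDeriv_apply,
      intervalIntegral.integral_same, sub_zero, intervalIntegral.integral_neg, sub_eq_add_neg]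
  · simp only [IccExtend_of_mem hL (edgeFun hL d) hx, IccExtend_of_mem hL (edgeFun hL d) h0,
      edgeFun_apply, intervalIntegral.integral_same, add_zero]

theorem edgeFun_injective (hL : 0 < L) : Function.Injective (edgeFun hL.le) := by
  refine (injective_iff_map_eq_zero _).2 fun d hd => ?_
  have h0 : (0 : ℝ) ∈ Icc 0 L := left_mem_Icc.2 hL.le
  obtain ⟨hderiv, hsnd⟩ := (isSobolevTwo_edgeFun hL.le d).eqOn_zero hL fun x hx => by
    simp [IccExtend_of_mem _ _ hx, hd]
  have hw : d.1 = 0 := by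
    refine Lp.ext (EventuallyEq.trans ?_ (Lp.coeFn_zero _ _ _).symm)
    filter_upwards [hsnd] with t ht using neg_eq_zero.1 ht
  have hval : edgeFun hL.le d ⟨0, h0⟩ = 0 := by rw [hd, ContinuousMap.zero_apply]
  have hslope : edgeDeriv L d ⟨0, h0⟩ = 0 := (IccExtend_of_mem _ _ h0).symm.trans (hderiv h0)
  rw [edgeFun_apply, intervalIntegral.integral_same, add_zero] at hval
  rw [edgeDeriv_apply, intervalIntegral.integral_same, sub_zero] at hslope
  exact Prod.ext hw (Prod.ext hval hslope)

end Edge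

namespace MetricGraph

variable {V E : Type*} (G : MetricGraph V E)

theorem length_nonneg (e : E) : 0 ≤ G.length e := (G.length_pos e).le

variable [Fintype E]

/-- The data of a function on the graph: `-f''` on every edge, and for each edge `e` the initial
value `f 0` at index `(e, false)` and the initial derivative `f' 0` at index `(e, true)`. -/
abbrev CauchyData : Type _ := GraphL2 G × (E × Bool → ℂ)

/-- The data of the restriction to an edge. -/
def cauchyEdge (e : E) : G.CauchyData →L[ℂ] EdgeData (G.length e) :=
  (PiLp.proj 2 (fun e => EdgeL2 (G.length e)) e ∘L ContinuousLinearMap.fst ℂ _ _).prod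
    ((ContinuousLinearMap.proj (e, false) ∘L ContinuousLinearMap.snd ℂ _ _).prod
      (ContinuousLinearMap.proj (e, true) ∘L ContinuousLinearMap.snd ℂ _ _))

/-- The function with given data, in `L²`. -/
def cauchyFun : G.CauchyData →L[ℂ] GraphL2 G :=
  (PiLp.continuousLinearEquiv 2 ℂ fun e => EdgeL2 (G.length e)).symm.toContinuousLinearMap ∘L
    ContinuousLinearMap.pi fun e =>
      toEdgeL2 (G.length_nonneg e) ∘L edgeFun (G.length_nonneg e) ∘L G.cauchyEdge e

theorem cauchyFun_apply (x : G.CauchyData) (e : E) :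
    G.cauchyFun x e =
      toEdgeL2 (G.length_nonneg e) (edgeFun (G.length_nonneg e) (G.cauchyEdge e x)) := rfl

theorem isCompactOperator_cauchyFun : IsCompactOperator G.cauchyFun :=
  IsCompactOperator.clm_comp
    (isCompactOperator_pi fun e => ((isCompactOperator_edgeFun (G.length_nonneg e)).comp_clm
      (G.cauchyEdge e)).clm_comp (toEdgeL2 (G.length_nonneg e)))
    (PiLp.continuousLinearEquiv 2 ℂ fun e => EdgeL2 (G.length e)).symm.toContinuousLinearMap

theorem cauchyFun_injective : Function.Injective G.cauchyFun := by
  refine (injective_iff_map_eq_zero _).2 fun x hx => ?_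
  have hzero (e : E) : G.cauchyEdge e x = 0 := by
    refine edgeFun_injective (G.length_pos e) (toEdgeL2_injective (G.length_pos e) ?_)
    rw [← G.cauchyFun_apply, hx, map_zero, map_zero, PiLp.zero_apply]
  refine Prod.ext (PiLp.ext fun e => congrArg Prod.fst (hzero e)) (funext ?_)
  rintro ⟨e, _ | _⟩
  · exact congrArg (fun d => d.2.1) (hzero e)
  · exact congrArg (fun d => d.2.2) (hzero e)

/-- Multiplication by a bounded potential. -/
def potentialOp {q : E → ℝ → ℝ} (hq : ∀ e, IsBoundedPotential (q e) (G.length e)) :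
    GraphL2 G →L[ℂ] GraphL2 G :=
  (PiLp.continuousLinearEquiv 2 ℂ fun e => EdgeL2 (G.length e)).symm.toContinuousLinearMap ∘L
    ContinuousLinearMap.pi fun e => mulPotential (hq e) ∘L PiLp.proj 2 _ e

/-- The point at an end of an edge. -/
def endPoint (h : E × Bool) : Icc (0 : ℝ) (G.length h.1) :=
  if h.2 then ⟨_, right_mem_Icc.2 (G.length_nonneg h.1)⟩
  else ⟨0, left_mem_Icc.2 (G.length_nonneg h.1)⟩

/-- The value at an end of an edge of the function with given data. -/
def cauchyValue (h : E × Bool) : G.CauchyData →L[ℂ] ℂ :=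
  ContinuousMap.evalCLM ℂ (G.endPoint h) ∘L edgeFun (G.length_nonneg h.1) ∘L G.cauchyEdge h.1

/-- The derivative into the edge, at an end of the edge, of the function with given data. -/
def cauchyDeriv (h : E × Bool) : G.CauchyData →L[ℂ] ℂ :=
  (if h.2 then -1 else 1 : ℂ) •
    (ContinuousMap.evalCLM ℂ (G.endPoint h) ∘L edgeDeriv (G.length h.1) ∘L G.cauchyEdge h.1)

theorem endValue_edgeFun (x : G.CauchyData) (h : E × Bool) :
    G.endValue (fun e => IccExtend (G.length_nonneg e)
      (edgeFun (G.length_nonneg e) (G.cauchyEdge e x))) h.1 h.2 = G.cauchyValue h x := by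
  obtain ⟨e, _ | _⟩ := h
  · exact IccExtend_of_mem _ _ (left_mem_Icc.2 (G.length_nonneg e))
  · exact IccExtend_of_mem _ _ (right_mem_Icc.2 (G.length_nonneg e))

theorem endDeriv_edgeDeriv (x : G.CauchyData) (h : E × Bool) :
    G.endDeriv (fun e => IccExtend (G.length_nonneg e)
      (edgeDeriv (G.length e) (G.cauchyEdge e x))) h.1 h.2 = G.cauchyDeriv h x := by
  obtain ⟨e, _ | _⟩ := h
  · refine (IccExtend_of_mem _ _ (left_mem_Icc.2 (G.length_nonneg e))).trans ?_
    simp [cauchyDeriv, endPoint]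
  · refine (congrArg Neg.neg
      (IccExtend_of_mem _ _ (right_mem_Icc.2 (G.length_nonneg e)))).trans ?_
    simp [cauchyDeriv, endPoint]

/-- The system that expresses `-f'' + Q f = g` and the conditions `φ h = 0` in terms of the data of
`f`. -/
def cauchySystem (Q : GraphL2 G →L[ℂ] GraphL2 G) (φ : E × Bool → G.CauchyData →L[ℂ] ℂ) :
    G.CauchyData →L[ℂ] G.CauchyData :=
  (ContinuousLinearMap.fst ℂ _ _ + Q ∘L G.cauchyFun).prod (ContinuousLinearMap.pi φ)

variable {G} {Q : GraphL2 G →L[ℂ] GraphL2 G} {φ : E × Bool → G.CauchyData →L[ℂ] ℂ}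

theorem isCompactOperator_cauchySystem_sub_one :
    IsCompactOperator (G.cauchySystem Q φ - 1 : G.CauchyData →L[ℂ] G.CauchyData) := by
  have hsub : G.cauchySystem Q φ - 1 =
      ContinuousLinearMap.inl ℂ _ _ ∘L Q ∘L G.cauchyFun + ContinuousLinearMap.inr ℂ _ _ ∘L
        (ContinuousLinearMap.pi φ - ContinuousLinearMap.snd ℂ (GraphL2 G) (E × Bool → ℂ)) := by
    refine ContinuousLinearMap.ext fun x => ?_
    simp [cauchySystem, Prod.ext_iff]
  rw [hsub]
  exact ((G.isCompactOperator_cauchyFun.clm_comp Q).clm_comp (ContinuousLinearMap.inl ℂ _ _)).add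
    ((isCompactOperator_of_locallyCompactSpace_dom _).clm_comp (ContinuousLinearMap.inr ℂ _ _))

theorem differentiable_cauchySystem {P : Type*} [NormedAddCommGroup P] [NormedSpace ℝ P]
    {φ : P → E × Bool → G.CauchyData →L[ℂ] ℂ} (hφ : ∀ h, Differentiable ℝ (φ · h)) :
    Differentiable ℝ fun p => G.cauchySystem Q (φ p) :=
  differentiable_prodCLM (differentiable_const _) (differentiable_piCLM hφ)

/-- The operator that takes `g` to the solution `f` of `-f'' + Q f = g` that satisfies the
conditions `φ h = 0`. -/
def cauchyResolvent (Q : GraphL2 G →L[ℂ] GraphL2 G) (φ : E × Bool → G.CauchyData →L[ℂ] ℂ) :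
    GraphL2 G →L[ℂ] GraphL2 G :=
  G.cauchyFun ∘L Ring.inverse (G.cauchySystem Q φ) ∘L ContinuousLinearMap.inl ℂ _ _

theorem isCompactOperator_cauchyResolvent : IsCompactOperator (cauchyResolvent Q φ) :=
  G.isCompactOperator_cauchyFun.comp_clm
    (Ring.inverse (G.cauchySystem Q φ) ∘L ContinuousLinearMap.inl ℂ _ _)

theorem exists_cauchyResolvent_eq (hinj : Function.Injective (G.cauchySystem Q φ))
    (g : GraphL2 G) : ∃ x, x.1 + Q (G.cauchyFun x) = g ∧ (∀ h, φ h x = 0) ∧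
      cauchyResolvent Q φ g = G.cauchyFun x := by
  have hunit := isUnit_of_isCompactOperator_sub_one isCompactOperator_cauchySystem_sub_one hinj
  have hsystem : G.cauchySystem Q φ (Ring.inverse (G.cauchySystem Q φ) (g, 0)) = (g, 0) :=
    DFunLike.congr_fun (Ring.mul_inverse_cancel _ hunit) (g, 0)
  exact ⟨_, congrArg Prod.fst hsystem, congrFun (congrArg Prod.snd hsystem), rfl⟩

theorem differentiable_cauchyResolvent {P : Type*} [NormedAddCommGroup P] [NormedSpace ℝ P]
    {φ : P → E × Bool → G.CauchyData →L[ℂ] ℂ} (hφ : ∀ h, Differentiable ℝ (φ · h))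
    (hinj : ∀ p, Function.Injective (G.cauchySystem Q (φ p))) :
    Differentiable ℝ fun p => cauchyResolvent Q (φ p) := fun p =>
  differentiableAt_comp_inverse_comp (differentiable_cauchySystem hφ p)
    (isUnit_of_isCompactOperator_sub_one isCompactOperator_cauchySystem_sub_one (hinj p)) _ _

end MetricGraph

/-! ### Unbounded operators and their resolvents -/

section Graph

variable {H : Type*} [NormedAddCommGroup H] [NormedSpace ℂ H] {T : H →ₗ.[ℂ] H} {z z₀ : ℂ}
  {R : H →L[ℂ] H}

theorem mem_eigenspace {u : H} : u ∈ eigenspace T z ↔ (u, z • u) ∈ T.graph := by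
  simp only [eigenspace, Submodule.mem_map, LinearMap.mem_ker, LinearMap.sub_apply, sub_eq_zero,
    LinearPMap.mem_graph_iff]
  exact exists_congr fun y => and_comm.trans (and_congr_right fun h => by rw [← h]; rfl)

variable (T z R) in
/-- The bounded operator `R` is the resolvent `(T - z)⁻¹`, in terms of the graph of `T`. -/
structure IsResolventAt : Prop where
  mem_graph : ∀ w, (R w, w + z • R w) ∈ T.graph
  apply_sub : ∀ u w, (u, w) ∈ T.graph → R (w - z • u) = u

theorem notMem_spec : z ∉ spec T ↔ ∃ R, IsResolventAt T z R := by
  have hgraph {u w : H} : (u, w) ∈ T.graph ↔ ∃ h : u ∈ T.domain, T ⟨u, h⟩ = w := by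
    simp [LinearPMap.mem_graph_iff]
  rw [spec, mem_ofPred_eq, not_not]
  refine exists_congr fun R => ⟨fun h => ⟨fun w => ?_, fun u w hu => ?_⟩, fun h =>
    ⟨fun w => ?_, fun u => h.apply_sub _ _ (T.mem_graph u)⟩⟩
  · obtain ⟨hw, hTw⟩ := h.1 w
    exact hgraph.2 ⟨hw, sub_eq_iff_eq_add.1 hTw⟩
  · obtain ⟨hdom, rfl⟩ := hgraph.1 hu
    exact h.2 ⟨u, hdom⟩
  · obtain ⟨hw, hTw⟩ := hgraph.1 (h.mem_graph w)
    exact ⟨hw, sub_eq_iff_eq_add.2 hTw⟩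

theorem IsResolventAt.of_eigenspace_eq_bot (hR : ∀ w, (R w, w + z • R w) ∈ T.graph)
    (hbot : eigenspace T z = ⊥) : IsResolventAt T z R := by
  refine ⟨hR, fun u w hu => sub_eq_zero.1 ((Submodule.eq_bot_iff _).1 hbot _ ?_)⟩
  convert mem_eigenspace.2 (?_ : (R (w - z • u) - u, z • (R (w - z • u) - u)) ∈ T.graph) using 1
  convert T.graph.sub_mem (hR (w - z • u)) hu using 1
  rw [Prod.mk_sub_mk, smul_sub]
  congr 1
  abel

theorem IsResolventAt.mem_eigenspace_iff (h : IsResolventAt T z₀ R) {u : H} :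
    u ∈ eigenspace T z ↔ (z - z₀) • R u = u := by
  rw [mem_eigenspace]
  refine ⟨fun hu => ?_, fun hu => ?_⟩
  · rw [← map_smul, sub_smul, h.apply_sub _ _ hu]
  · have hmem := T.graph.smul_mem (z - z₀) (h.mem_graph u)
    rwa [Prod.smul_mk, smul_add, smul_comm (z - z₀) z₀, hu, ← add_smul, sub_add_cancel] at hmem

end Graph

section BoundedBelow

variable {H : Type*} [NormedAddCommGroup H] [InnerProductSpace ℂ H] {T : H →ₗ.[ℂ] H} {m K : ℝ}
  {R : H →L[ℂ] H}

variable (T m) in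
/-- The operator `T` is symmetric, with `⟪u, T u⟫ ≥ m ‖u‖²`. -/
structure IsSymmetricBoundedBelow : Prop where
  inner_comm : ∀ u w u' w', (u, w) ∈ T.graph → (u', w') ∈ T.graph → inner ℂ w u' = inner ℂ u w'
  le_inner : ∀ u w, (u, w) ∈ T.graph → m * ‖u‖ ^ 2 ≤ (inner ℂ u w).re

namespace IsSymmetricBoundedBelow

theorem eigenspace_eq_bot_of_im_ne_zero (hT : IsSymmetricBoundedBelow T m) {z : ℂ}
    (hz : z.im ≠ 0) : eigenspace T z = ⊥ := by
  refine (Submodule.eq_bot_iff _).2 fun u hu => ?_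
  have hcomm := hT.inner_comm _ _ _ _ (mem_eigenspace.1 hu) (mem_eigenspace.1 hu)
  rw [inner_smul_left, inner_smul_right] at hcomm
  by_contra hu0
  exact hz (Complex.conj_eq_iff_im.1 (mul_right_cancel₀ (inner_self_ne_zero.2 hu0) hcomm))

theorem eigenspace_eq_bot_of_lt (hT : IsSymmetricBoundedBelow T m) {s : ℝ} (hs : s < m) :
    eigenspace T (s : ℂ) = ⊥ := by
  refine (Submodule.eq_bot_iff _).2 fun u hu => ?_
  have hle := hT.le_inner _ _ (mem_eigenspace.1 hu)
  have hself : (inner ℂ u u).re = ‖u‖ ^ 2 := inner_self_eq_norm_sq (𝕜 := ℂ) u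
  rw [inner_smul_right, Complex.re_ofReal_mul, hself] at hle
  by_contra hu0
  have hpos : 0 < ‖u‖ ^ 2 := by positivity
  nlinarith

theorem isSymmetric_of_isResolventAt (hT : IsSymmetricBoundedBelow T m)
    (hR : IsResolventAt T (-K : ℝ) R) : R.IsSymmetric := fun g g' => by
  have h := hT.inner_comm _ _ _ _ (hR.mem_graph g) (hR.mem_graph g')
  rw [inner_add_left, inner_add_right, inner_smul_left, inner_smul_right, Complex.conj_ofReal] at h
  exact (add_right_cancel h).symm

theorem reApplyInnerSelf_pos (hT : IsSymmetricBoundedBelow T m) (hR : IsResolventAt T (-K : ℝ) R)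
    (hK : -K < m) {g : H} (hg : g ≠ 0) : 0 < R.reApplyInnerSelf g := by
  have hmem := hR.mem_graph g
  have hRg : R g ≠ 0 := fun h0 => hg <| by
    rw [h0, smul_zero, add_zero] at hmem
    exact T.graph_fst_eq_zero_snd hmem rfl
  have hle := hT.le_inner _ _ hmem
  have hself : (inner ℂ (R g) (R g)).re = ‖R g‖ ^ 2 :=
    inner_self_eq_norm_sq (𝕜 := ℂ) (R g)
  rw [inner_add_right, inner_smul_right, Complex.add_re, Complex.re_ofReal_mul, hself] at hle
  have hpos : 0 < ‖R g‖ ^ 2 := by positivity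
  rw [ContinuousLinearMap.reApplyInnerSelf_apply, RCLike.re_to_complex]
  nlinarith

theorem eigenResolvent (hT : IsSymmetricBoundedBelow T m) (hR : IsResolventAt T (-K : ℝ) R)
    (hK : -K < m) : EigenResolvent T K R := by
  refine ⟨fun s hs => hT.eigenspace_eq_bot_of_lt (hs.trans_lt hK), fun s hs => ?_⟩
  have hs0 : ((s + K : ℝ) : ℂ) ≠ 0 := Complex.ofReal_ne_zero.2 (by linarith)
  ext u
  rw [hR.mem_eigenspace_iff, Module.End.mem_eigenspace_iff, Complex.ofReal_inv,
    eq_inv_smul_iff₀ hs0, Complex.ofReal_neg, sub_neg_eq_add, ← Complex.ofReal_add]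
  rfl

end IsSymmetricBoundedBelow

end BoundedBelow

/-! ### The resolvent of `H^α` -/

namespace MetricGraph

section Delta

variable {V E M : Type*} (G : MetricGraph V E)

/-- A representative of the edge ends at the same vertex as `h`. -/
def baseEnd (h : E × Bool) : E × Bool :=
  (Quotient.mk (Setoid.ker fun h : E × Bool => G.endpoint h.1 h.2) h).out

theorem endpoint_baseEnd (h : E × Bool) :
    G.endpoint (G.baseEnd h).1 (G.baseEnd h).2 = G.endpoint h.1 h.2 :=
  Quotient.exact (s := Setoid.ker fun h : E × Bool => G.endpoint h.1 h.2) (Quotient.out_eq _)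

theorem baseEnd_eq {h h' : E × Bool} (hh : G.endpoint h.1 h.2 = G.endpoint h'.1 h'.2) :
    G.baseEnd h = G.baseEnd h' :=
  congrArg Quotient.out (Quotient.sound' hh)

variable [Fintype E] [AddCommGroup M] [Module ℂ M]

/-- The vertex condition with coefficient `χ`, for values `F` and derivatives `F'` at the edge ends,
written as one equation `deltaDefect = 0` for every edge end `h` at the vertex. The sum of
derivatives occurs in each of these equations; at the representative end, the other term
vanishes. -/
def deltaDefect (F F' : E × Bool → M) (h : E × Bool) : WithTop ℝ → M
  | ⊤ => F h
  | (r : ℝ) => F h - F (G.baseEnd h) +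
      (G.vertexSum F' (G.endpoint h.1 h.2) - (r : ℂ) • F (G.baseEnd h))

theorem map_deltaDefect {N : Type*} [AddCommGroup N] [Module ℂ N] (φ : M →ₗ[ℂ] N)
    (F F' : E × Bool → M) (h : E × Bool) (χ : WithTop ℝ) :
    φ (G.deltaDefect F F' h χ) =
      G.deltaDefect (fun h => φ (F h)) (fun h => φ (F' h)) h χ := by
  cases χ with
  | top => rfl
  | coe r => simp [deltaDefect, vertexSum, map_sum, apply_ite φ]

variable {G}

theorem deltaCondition_of_deltaDefect_eq_zero {f f₁ : E → ℝ → ℂ} {v : V} {χ : WithTop ℝ}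
    (hzero : ∀ h : E × Bool, G.endpoint h.1 h.2 = v →
      G.deltaDefect (fun h => G.endValue f h.1 h.2) (fun h => G.endDeriv f₁ h.1 h.2) h χ = 0) :
    G.DeltaCondition f f₁ v χ := by
  cases χ with
  | top => exact ⟨0, fun e b hv => hzero (e, b) hv, fun _ => rfl, fun r hr => by simp at hr⟩
  | coe r =>
    by_cases hex : ∃ h : E × Bool, G.endpoint h.1 h.2 = v
    · obtain ⟨h₀, rfl⟩ := hex
      have hbase := G.endpoint_baseEnd h₀
      have hsum := hzero _ hbase
      simp only [deltaDefect, G.baseEnd_eq hbase, hbase, sub_self, zero_add, sub_eq_zero] at hsum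
      refine ⟨G.endValue f (G.baseEnd h₀).1 (G.baseEnd h₀).2, fun e b hv => ?_, by simp, ?_⟩
      · have hdefect := hzero (e, b) hv
        simpa only [deltaDefect, G.baseEnd_eq (h := (e, b)) hv, hv, hsum, sub_self, add_zero,
          sub_eq_zero] using hdefect
      · rintro r' hr
        obtain rfl : r = r' := WithTop.coe_injective hr
        exact hsum
    · push Not at hex
      refine ⟨0, fun e b hv => absurd hv (hex (e, b)), fun _ => rfl, fun r' _ => ?_⟩
      rw [mul_zero]
      exact G.vertexSum_eq_zero hex

end Delta

end MetricGraph

section MagneticResolvent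

variable {V E : Type*} [Fintype V] [Fintype E] {Γ : QuantumGraph V E} {c : Cut Γ.toMetricGraph}
  {z : ℂ} {α : Fin Γ.betti → ℝ}

section BoundaryDefect

variable {M : Type*} [AddCommGroup M] [Module ℂ M]

variable (Γ c α) in
/-- The vertex conditions of `H^α`, for values `F` and derivatives `F'` at the edge ends, written as
one equation `boundaryDefect = 0` for every edge end of the cut tree. -/
def boundaryDefect (F F' : TreeEdge c × Bool → M) (h : TreeEdge c × Bool) : M :=
  match (cutTree c).endpoint h.1 h.2 with
  | Sum.inl v => (cutTree c).deltaDefect F F' h (Γ.χ v)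
  | Sum.inr (j, false) =>
      F (Sum.inr (j, true), false) - Complex.exp (Complex.I * α j) • F (Sum.inr (j, false), true)
  | Sum.inr (j, true) =>
      F' (Sum.inr (j, true), false) + Complex.exp (Complex.I * α j) • F' (Sum.inr (j, false), true)

theorem map_boundaryDefect {N : Type*} [AddCommGroup N] [Module ℂ N] (φ : M →ₗ[ℂ] N)
    (F F' : TreeEdge c × Bool → M) (h : TreeEdge c × Bool) :
    φ (boundaryDefect Γ c α F F' h) =
      boundaryDefect Γ c α (fun h => φ (F h)) (fun h => φ (F' h)) h := by
  simp only [boundaryDefect]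
  split
  · exact (cutTree c).map_deltaDefect φ F F' h _
  · simp
  · simp

theorem vertexConditions_of_boundaryDefect_eq_zero {f f₁ : TreeEdge c → ℝ → ℂ}
    (hzero : ∀ h, boundaryDefect Γ c α (fun h => (cutTree c).endValue f h.1 h.2)
      (fun h => (cutTree c).endDeriv f₁ h.1 h.2) h = 0) : VertexConditions Γ c α f f₁ := by
  refine ⟨fun v => MetricGraph.deltaCondition_of_deltaDefect_eq_zero fun h hv => ?_, fun j => ?_,
    fun j => ?_⟩
  · have hh := hzero h
    rwa [boundaryDefect, hv] at hh
  · exact sub_eq_zero.1 (hzero (Sum.inr (j, false), true))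
  · exact (eq_neg_of_add_eq_zero_left (hzero (Sum.inr (j, true), false))).trans
      (neg_mul _ _).symm

theorem differentiable_boundaryDefect {M : Type*} [NormedAddCommGroup M] [NormedSpace ℂ M]
    (F F' : TreeEdge c × Bool → M) (h : TreeEdge c × Bool) :
    Differentiable ℝ fun α => boundaryDefect Γ c α F F' h := by
  have hexp (j : Fin Γ.betti) :
      Differentiable ℝ fun α : Fin Γ.betti → ℝ => Complex.exp (Complex.I * α j) :=
    ((Complex.ofRealCLM.differentiable.comp (differentiable_apply j)).const_mul _).cexp
  simp only [boundaryDefect]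
  split
  · exact differentiable_const _
  · exact (differentiable_const _).sub ((hexp _).smul_const _)
  · exact (differentiable_const _).add ((hexp _).smul_const _)

end BoundaryDefect

theorem inGraph_of_boundaryDefect_eq_zero {x : (cutTree c).CauchyData}
    (hx : ∀ h, boundaryDefect Γ c α (cutTree c).cauchyValue (cutTree c).cauchyDeriv h x = 0) :
    InGraph Γ c α ((cutTree c).cauchyFun x) (x.1 +
      (cutTree c).potentialOp (isBoundedPotential_treePotential Γ c)
        ((cutTree c).cauchyFun x)) := by
  have hu (e : TreeEdge c) := coeFn_toEdgeL2 ((cutTree c).length_nonneg e)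
    (edgeFun ((cutTree c).length_nonneg e) ((cutTree c).cauchyEdge e x))
  refine ⟨_, _, _, fun e => isSobolevTwo_edgeFun ((cutTree c).length_nonneg e)
    ((cutTree c).cauchyEdge e x), vertexConditions_of_boundaryDefect_eq_zero fun h => ?_, hu,
    fun e => ?_⟩
  · simp only [MetricGraph.endValue_edgeFun, MetricGraph.endDeriv_edgeDeriv]
    exact (map_boundaryDefect (ContinuousLinearMap.apply ℂ ℂ x).toLinearMap _ _ h).symm.trans (hx h)
  · filter_upwards [Lp.coeFn_add (x.1 e) ((cutTree c).potentialOp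
      (isBoundedPotential_treePotential Γ c) ((cutTree c).cauchyFun x) e), hu e, coeFn_mulPotential
      (isBoundedPotential_treePotential Γ c e) ((cutTree c).cauchyFun x e)] with t hadd hut hmul
    rw [neg_neg, ← hut]
    exact hadd.trans (congrArg (x.1 e t + ·) hmul)

variable (Γ c z) in
/-- The operator `Q` for which `(H^α - z) f = -f'' + Q f`. -/
def shiftedPotential : GraphL2 (cutTree c) →L[ℂ] GraphL2 (cutTree c) :=
  (cutTree c).potentialOp (isBoundedPotential_treePotential Γ c) - z • 1

variable (Γ c z α) in
/-- The resolvent `(H^α - z)⁻¹`, if `z` is not an eigenvalue. -/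
def magneticResolvent : GraphL2 (cutTree c) →L[ℂ] GraphL2 (cutTree c) :=
  MetricGraph.cauchyResolvent (shiftedPotential Γ c z)
    (boundaryDefect Γ c α (cutTree c).cauchyValue (cutTree c).cauchyDeriv)

theorem mem_graph_of_cauchyData {x : (cutTree c).CauchyData} {g : GraphL2 (cutTree c)}
    (hx : ∀ h, boundaryDefect Γ c α (cutTree c).cauchyValue (cutTree c).cauchyDeriv h x = 0)
    (hg : x.1 + shiftedPotential Γ c z ((cutTree c).cauchyFun x) = g) :
    ((cutTree c).cauchyFun x, g + z • (cutTree c).cauchyFun x) ∈ (magneticOp Γ c α).graph := by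
  convert (mem_graph_magneticOp Γ c α _ _).2 (inGraph_of_boundaryDefect_eq_zero hx) using 2
  rw [← hg, shiftedPotential, sub_apply, smul_apply, one_apply_eq_self]
  abel

theorem cauchySystem_injective (hz : eigenspace (magneticOp Γ c α) z = ⊥) :
    Function.Injective ((cutTree c).cauchySystem (shiftedPotential Γ c z)
      (boundaryDefect Γ c α (cutTree c).cauchyValue (cutTree c).cauchyDeriv)) := by
  refine (injective_iff_map_eq_zero _).2 fun x hx => (cutTree c).cauchyFun_injective ?_
  have hmem := mem_graph_of_cauchyData (congrFun (congrArg Prod.snd hx)) (congrArg Prod.fst hx)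
  rw [Prod.fst_zero, zero_add] at hmem
  rw [map_zero]
  exact (Submodule.eq_bot_iff _).1 hz _ (mem_eigenspace.2 hmem)

theorem isResolventAt_magneticResolvent (hz : eigenspace (magneticOp Γ c α) z = ⊥) :
    IsResolventAt (magneticOp Γ c α) z (magneticResolvent Γ c z α) := by
  refine .of_eigenspace_eq_bot (fun g => ?_) hz
  obtain ⟨x, hg, hx, hR⟩ := MetricGraph.exists_cauchyResolvent_eq (cauchySystem_injective hz) g
  rw [magneticResolvent, hR]
  exact mem_graph_of_cauchyData hx hg

theorem isCompactOperator_magneticResolvent : IsCompactOperator (magneticResolvent Γ c z α) :=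
  MetricGraph.isCompactOperator_cauchyResolvent

theorem differentiable_magneticResolvent (hz : ∀ α, eigenspace (magneticOp Γ c α) z = ⊥) :
    Differentiable ℝ (magneticResolvent Γ c z) :=
  MetricGraph.differentiable_cauchyResolvent (fun h => differentiable_boundaryDefect _ _ h)
    fun α => cauchySystem_injective (hz α)

theorem exists_isSymmetricBoundedBelow (Γ : QuantumGraph V E) (c : Cut Γ.toMetricGraph) :
    ∃ m, ∀ α, IsSymmetricBoundedBelow (magneticOp Γ c α) m := by
  obtain ⟨K, hK⟩ := exists_lowerBound Γ c
  refine ⟨-K, fun α => ⟨fun u w u' w' h h' => ?_, fun u w h => ?_⟩⟩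
  · rw [mem_graph_magneticOp] at h h'
    exact h.inner_comm h'
  · rw [neg_mul]
    exact hK α u w ((mem_graph_magneticOp Γ c α u w).1 h)

theorem notMem_spec_magneticOp_of_im_ne_zero (hz : z.im ≠ 0) : z ∉ spec (magneticOp Γ c α) := by
  obtain ⟨m, hm⟩ := exists_isSymmetricBoundedBelow Γ c
  exact notMem_spec.2
    ⟨_, isResolventAt_magneticResolvent ((hm α).eigenspace_eq_bot_of_im_ne_zero hz)⟩

end MagneticResolvent

/-! ### Complex conjugation -/

section ConjugateOperators

variable {H : Type*} [NormedAddCommGroup H] [NormedSpace ℂ H] {J : H ≃ₛₗᵢ[starRingEnd ℂ] H}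
  {T T' : H →ₗ.[ℂ] H}

theorem rank_map_antiunitary (J : H ≃ₛₗᵢ[starRingEnd ℂ] H) (p : Submodule ℂ H) :
    Module.rank ℂ (p.map J.toLinearEquiv.toLinearMap) = Module.rank ℂ p :=
  (rank_eq_of_equiv_equiv (starRingEnd ℂ) (J.toLinearEquiv.submoduleMap p).toAddEquiv
    (Function.Involutive.bijective Complex.conj_conj)
    (J.toLinearEquiv.submoduleMap p).map_smulₛₗ).symm

variable (J T T') in
/-- The antiunitary `J` transforms `T` into `T'`, that is `T' = J T J⁻¹`. -/
def IsAntiunitarilyEquivalent : Prop :=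
  ∀ u w, (J u, J w) ∈ T'.graph ↔ (u, w) ∈ T.graph

namespace IsAntiunitarilyEquivalent

theorem symm (h : IsAntiunitarilyEquivalent J T T') : IsAntiunitarilyEquivalent J.symm T' T :=
  fun u w => by rw [← h, J.apply_symm_apply, J.apply_symm_apply]

theorem star_notMem_spec (h : IsAntiunitarilyEquivalent J T T') {z : ℂ} (hz : z ∉ spec T) :
    star z ∉ spec T' := by
  obtain ⟨R, hR⟩ := notMem_spec.1 hz
  let R' : H →L[ℂ] H := (J : H →SL[starRingEnd ℂ] H).comp (R.comp (J.symm : H →SL[starRingEnd ℂ] H))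
  have hR' (w : H) : R' w = J (R (J.symm w)) := rfl
  have hsmul (u : H) : J (z • u) = star z • J u := map_smulₛₗ J z u
  refine notMem_spec.2 ⟨R', fun w => ?_, fun u w hu => ?_⟩
  · have hmem := (h _ _).2 (hR.mem_graph (J.symm w))
    rwa [map_add, hsmul, J.apply_symm_apply] at hmem
  · have hsub : J.symm (w - star z • u) = J.symm w - z • J.symm u := by
      rw [J.symm_apply_eq, map_sub, hsmul, J.apply_symm_apply, J.apply_symm_apply]
    rw [hR', hsub, hR.apply_sub _ _ ((h.symm _ _).2 hu), J.apply_symm_apply]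

theorem star_mem_spec_iff (h : IsAntiunitarilyEquivalent J T T') {z : ℂ} :
    star z ∈ spec T' ↔ z ∈ spec T := by
  refine not_iff_not.1 ⟨fun hz => ?_, h.star_notMem_spec⟩
  rw [← star_star z]
  exact h.symm.star_notMem_spec hz

theorem map_eigenspace (h : IsAntiunitarilyEquivalent J T T') (z : ℂ) :
    (eigenspace T z).map J.toLinearEquiv.toLinearMap = eigenspace T' (star z) := by
  ext u
  obtain ⟨v, rfl⟩ := J.surjective u
  have hsmul : J (z • v) = star z • J v := map_smulₛₗ J z v
  rw [mem_eigenspace, ← hsmul, h, ← mem_eigenspace]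
  exact J.injective.mem_set_image (s := (eigenspace T z : Set H))

theorem multiplicity_star (h : IsAntiunitarilyEquivalent J T T') (z : ℂ) :
    multiplicity T' (star z) = multiplicity T z := by
  rw [multiplicity, ← h.map_eigenspace, rank_map_antiunitary, multiplicity]

theorem eigenCount_eq (h : IsAntiunitarilyEquivalent J T T') (t : ℝ) :
    eigenCount T' t = eigenCount T t := by
  have hmap (s : ℝ) : (eigenspace T (s : ℂ)).map J.toLinearEquiv.toLinearMap = eigenspace T' s := by
    rw [h.map_eigenspace, Complex.star_def, Complex.conj_ofReal]
  have hsup : (⨆ s ∈ Iic t, eigenspace T (s : ℂ)).map J.toLinearEquiv.toLinearMap =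
      ⨆ s ∈ Iic t, eigenspace T' (s : ℂ) := by
    simp only [Submodule.map_iSup, hmap]
  rw [eigenCount, eigenCount, ← hsup, rank_map_antiunitary]

theorem nthEigenvalue_eq (h : IsAntiunitarilyEquivalent J T T') (n : ℕ) :
    nthEigenvalue T' n = nthEigenvalue T n := by
  simp only [nthEigenvalue, h.eigenCount_eq]

end IsAntiunitarilyEquivalent

end ConjugateOperators

section Conjugation

theorem norm_star_edgeL2 {L : ℝ} (f : EdgeL2 L) : ‖star f‖ = ‖f‖ := by
  rw [Lp.norm_def, Lp.norm_def, eLpNorm_congr_ae (Lp.coeFn_star f)]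
  exact congrArg _ (eLpNorm_congr_norm_ae (Eventually.of_forall fun x => norm_star (f x)))

theorem star_add_edgeL2 {L : ℝ} (f g : EdgeL2 L) : star (f + g) = star f + star g := by
  refine Lp.ext ?_
  filter_upwards [Lp.coeFn_star (f + g), Lp.coeFn_add f g, Lp.coeFn_add (star f) (star g),
    Lp.coeFn_star f, Lp.coeFn_star g] with x h₁ h₂ h₃ h₄ h₅
  simp only [h₁, h₂, h₃, h₄, h₅, Pi.star_apply, Pi.add_apply, star_add]

theorem star_smul_edgeL2 {L : ℝ} (z : ℂ) (f : EdgeL2 L) : star (z • f) = star z • star f := by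
  refine Lp.ext ?_
  filter_upwards [Lp.coeFn_star (z • f), Lp.coeFn_smul z f, Lp.coeFn_smul (star z) (star f),
    Lp.coeFn_star f] with x h₁ h₂ h₃ h₄
  simp only [h₁, h₂, h₃, h₄, Pi.star_apply, Pi.smul_apply, smul_eq_mul, star_mul']

variable {V E : Type*} [Fintype E]

/-- Complex conjugation on `L²(G, ℂ)`, edge by edge. -/
def conjEquiv (G : MetricGraph V E) : GraphL2 G ≃ₛₗᵢ[starRingEnd ℂ] GraphL2 G where
  toLinearEquiv := LinearEquiv.ofInvolutive
    { toFun := fun u => WithLp.toLp 2 fun e => star (u e)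
      map_add' := fun u v => PiLp.ext fun e => star_add_edgeL2 (u e) (v e)
      map_smul' := fun z u => PiLp.ext fun e => star_smul_edgeL2 z (u e) }
    fun u => PiLp.ext fun e => star_star (u e)
  norm_map' u := by
    rw [PiLp.norm_eq_of_L2, PiLp.norm_eq_of_L2]
    exact congrArg _ (Finset.sum_congr rfl fun e _ => congrArg (· ^ 2) (norm_star_edgeL2 (u e)))

theorem conjEquiv_conjEquiv {G : MetricGraph V E} (u : GraphL2 G) :
    conjEquiv G (conjEquiv G u) = u :=
  PiLp.ext fun e => star_star (u e)

theorem coeFn_conjEquiv {G : MetricGraph V E} (u : GraphL2 G) (e : E) :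
    conjEquiv G u e =ᵐ[volume.restrict (Icc 0 (G.length e))] fun x => star (u e x) :=
  Lp.coeFn_star (u e)

variable [Fintype V] {Γ : QuantumGraph V E} {c : Cut Γ.toMetricGraph} {α α' : Fin Γ.betti → ℝ}

theorem VertexConditions.conj
    (hα : ∀ j, Complex.exp (Complex.I * α' j) = star (Complex.exp (Complex.I * α j)))
    {f f₁ : TreeEdge c → ℝ → ℂ} (h : VertexConditions Γ c α f f₁) :
    VertexConditions Γ c α' (fun e x => star (f e x)) (fun e x => star (f₁ e x)) := by
  have hval (e b) : (cutTree c).endValue (fun e x => star (f e x)) e b =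
      star ((cutTree c).endValue f e b) := by cases b <;> rfl
  have hderiv (e b) : (cutTree c).endDeriv (fun e x => star (f₁ e x)) e b =
      star ((cutTree c).endDeriv f₁ e b) := by
    cases b
    · rfl
    · exact (star_neg _).symm
  refine ⟨fun v => ?_, fun j => ?_, fun j => ?_⟩
  · obtain ⟨a, hcont, hdirichlet, hflux⟩ := h.delta v
    refine ⟨star a, fun e b he => by rw [hval, hcont e b he],
      fun hχ => by rw [hdirichlet hχ, star_zero], fun r hr => ?_⟩
    have hstar := congrArg star (hflux r hr)
    rw [star_sum, star_mul', show star (r : ℂ) = r from Complex.conj_ofReal r] at hstar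
    rw [← hstar]
    refine Finset.sum_congr rfl fun e _ => ?_
    split_ifs
    · exact hderiv _ _
    · exact (star_zero ℂ).symm
  · rw [hval, hval, h.jump j, star_mul', hα]
  · rw [hderiv, hderiv, h.jump_deriv j, star_mul', star_neg, hα]

theorem InGraph.conj
    (hα : ∀ j, Complex.exp (Complex.I * α' j) = star (Complex.exp (Complex.I * α j)))
    {u w : GraphL2 (cutTree c)} (h : InGraph Γ c α u w) :
    InGraph Γ c α' (conjEquiv _ u) (conjEquiv _ w) := by
  obtain ⟨f, f₁, f₂, hsob, hvertex, hu, hw⟩ := h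
  refine ⟨fun e x => star (f e x), fun e x => star (f₁ e x), fun e x => star (f₂ e x),
    fun e => (hsob e).conj, hvertex.conj hα, fun e => ?_, fun e => ?_⟩
  · filter_upwards [coeFn_conjEquiv u e, hu e] with x hconj hx
    rw [hconj, hx]
  · filter_upwards [coeFn_conjEquiv w e, hw e] with x hconj hx
    rw [hconj, hx]
    simp

theorem isAntiunitarilyEquivalent_magneticOp
    (hα : ∀ j, Complex.exp (Complex.I * α' j) = star (Complex.exp (Complex.I * α j))) :
    IsAntiunitarilyEquivalent (conjEquiv (cutTree c)) (magneticOp Γ c α) (magneticOp Γ c α') := by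
  intro u w
  rw [mem_graph_magneticOp, mem_graph_magneticOp]
  refine ⟨fun h => ?_, InGraph.conj hα⟩
  rw [← conjEquiv_conjEquiv u, ← conjEquiv_conjEquiv w]
  exact h.conj fun j => by rw [hα, star_star]

theorem spec_magneticOp_conj
    (hα : ∀ j, Complex.exp (Complex.I * α' j) = star (Complex.exp (Complex.I * α j))) :
    spec (magneticOp Γ c α) = spec (magneticOp Γ c α') := by
  ext z
  by_cases him : z.im = 0
  · have hz : star z = z := Complex.conj_eq_iff_im.2 him
    rw [← (isAntiunitarilyEquivalent_magneticOp hα).star_mem_spec_iff, hz]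
  · exact iff_of_false (notMem_spec_magneticOp_of_im_ne_zero him)
      (notMem_spec_magneticOp_of_im_ne_zero him)

theorem multiplicity_magneticOp_conj
    (hα : ∀ j, Complex.exp (Complex.I * α' j) = star (Complex.exp (Complex.I * α j))) (z : ℂ) :
    multiplicity (magneticOp Γ c α) z = multiplicity (magneticOp Γ c α') z := by
  by_cases him : z.im = 0
  · have hz : star z = z := Complex.conj_eq_iff_im.2 him
    rw [← (isAntiunitarilyEquivalent_magneticOp hα).multiplicity_star, hz]
  · obtain ⟨m, hm⟩ := exists_isSymmetricBoundedBelow Γ c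
    rw [multiplicity, multiplicity, (hm α).eigenspace_eq_bot_of_im_ne_zero him,
      (hm α').eigenspace_eq_bot_of_im_ne_zero him]

theorem nthEigenvalue_magneticOp_conj
    (hα : ∀ j, Complex.exp (Complex.I * α' j) = star (Complex.exp (Complex.I * α j))) (n : ℕ) :
    nthEigenvalue (magneticOp Γ c α) n = nthEigenvalue (magneticOp Γ c α') n :=
  ((isAntiunitarilyEquivalent_magneticOp hα).nthEigenvalue_eq n).symm

theorem exp_add_eq_star_exp_sub_of_mem_symmetryPoints {β : ℕ} {ς : Fin β → ℝ}
    (hς : ς ∈ symmetryPoints β) (α : Fin β → ℝ) (j : Fin β) :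
    Complex.exp (Complex.I * (ς + α) j) = star (Complex.exp (Complex.I * (ς - α) j)) := by
  obtain ⟨b, rfl⟩ := hς
  rw [Complex.star_def, ← Complex.exp_conj, Complex.exp_eq_exp_iff_exists_int]
  refine ⟨(b j : ℕ), ?_⟩
  simp only [Pi.add_apply, Pi.sub_apply, map_mul, Complex.conj_I, Complex.conj_ofReal]
  push_cast
  ring

end Conjugation

/-! ### Differentiability of simple eigenvalues -/

section SimpleEigenvalues

variable {V E : Type*} [Fintype E]

theorem not_finiteDimensional_graphL2 (G : MetricGraph V E) [Nonempty E] :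
    ¬ FiniteDimensional ℂ (GraphL2 G) := by
  classical
  intro hfin
  obtain ⟨e⟩ := ‹Nonempty E›
  refine not_finiteDimensional_edgeL2 (G.length_pos e) ?_
  refine Module.Finite.of_surjective
    (PiLp.projₗ 2 (fun e => EdgeL2 (G.length e)) e : GraphL2 G →ₗ[ℂ] _) fun y => ?_
  exact ⟨WithLp.toLp 2 (Pi.single e y), by simp⟩

theorem nonempty_edge_of_multiplicity_ne_zero {G : MetricGraph V E} {T : GraphL2 G →ₗ.[ℂ] GraphL2 G}
    {z : ℂ} (h : multiplicity T z ≠ 0) : Nonempty E := by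
  by_contra hE
  have : IsEmpty E := not_nonempty_iff.1 hE
  have : Subsingleton (GraphL2 G) := ⟨fun _ _ => PiLp.ext isEmptyElim⟩
  exact h (rank_subsingleton' ℂ _)

theorem differentiableAt_nthEigenvalue_magneticOp [Fintype V] {Γ : QuantumGraph V E}
    {c : Cut Γ.toMetricGraph} {α : Fin Γ.betti → ℝ} {n : ℕ} (hn : 1 ≤ n)
    (hsimple : multiplicity (magneticOp Γ c α) (nthEigenvalue (magneticOp Γ c α) n : ℂ) = 1) :
    DifferentiableAt ℝ (fun α => nthEigenvalue (magneticOp Γ c α) n) α := by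
  obtain ⟨m, hm⟩ := exists_isSymmetricBoundedBelow Γ c
  obtain ⟨K, hK⟩ : ∃ K : ℝ, -K < m := ⟨1 - m, by linarith⟩
  have hbot (α) := (hm α).eigenspace_eq_bot_of_lt hK
  have hR (α) := isResolventAt_magneticResolvent (hbot α)
  have hsymm (α) := (hm α).isSymmetric_of_isResolventAt (hR α)
  have : Nonempty (TreeEdge c) :=
    nonempty_edge_of_multiplicity_ne_zero (hsimple.trans_ne one_ne_zero)
  exact EigenResolvent.differentiableAt_nthEigenvalue (fun α => (hm α).eigenResolvent (hR α) hK)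
    (fun _ => isCompactOperator_magneticResolvent) hsymm
    (differentiable_magneticResolvent hbot α) hn
    (exists_le_rank_eigenspaceSum isCompactOperator_magneticResolvent (hsymm α)
      (fun _ hg => (hm α).reApplyInnerSelf_pos (hR α) hK hg)
      (not_finiteDimensional_graphL2 (cutTree c)) n) hsimple

theorem hasFDerivAt_zero_of_even {X F : Type*} [NormedAddCommGroup X] [NormedSpace ℝ X]
    [NormedAddCommGroup F] [NormedSpace ℝ F] {f : X → F} {x₀ : X} (hd : DifferentiableAt ℝ f x₀)
    (heven : ∀ x, f (x₀ - x) = f (x₀ + x)) : HasFDerivAt f (0 : X →L[ℝ] F) x₀ := by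
  obtain ⟨f', hf'⟩ := hd
  have hadd : HasFDerivAt (fun x => f (x₀ + x)) f' 0 := by
    rwa [hasFDerivAt_comp_add_left, add_zero]
  have hsub : HasFDerivAt (fun x => f (x₀ - x)) (-f') 0 := by
    rw [← sub_zero x₀] at hf'
    simpa [Function.comp_def] using
      hf'.comp (0 : X) ((hasFDerivAt_id (𝕜 := ℝ) (0 : X)).const_sub x₀)
  simp only [heven] at hsub
  have : IsAddTorsionFree (X →L[ℝ] F) := .of_isTorsionFree ℝ _
  rwa [← self_eq_neg.1 (hadd.unique hsub)]

end SimpleEigenvalues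

end QG

end

theorem mainTheorem7 {V E : Type*} [Fintype V] [Fintype E] (Γ : QG.QuantumGraph V E)
    (c : QG.Cut Γ.toMetricGraph) (ς : Fin Γ.betti → ℝ) (hς : ς ∈ QG.symmetryPoints Γ.betti) :
    (∀ α : Fin Γ.betti → ℝ,
      QG.spec (QG.magneticOp Γ c (ς - α)) = QG.spec (QG.magneticOp Γ c (ς + α)) ∧
      ∀ z : ℂ, QG.multiplicity (QG.magneticOp Γ c (ς - α)) z =
        QG.multiplicity (QG.magneticOp Γ c (ς + α)) z) ∧
    ∀ n : ℕ, 1 ≤ n →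
      QG.multiplicity (QG.magneticOp Γ c ς) (QG.nthEigenvalue (QG.magneticOp Γ c ς) n : ℂ) = 1 →
      HasFDerivAt (fun α : Fin Γ.betti → ℝ => QG.nthEigenvalue (QG.magneticOp Γ c α) n)
        (0 : (Fin Γ.betti → ℝ) →L[ℝ] ℝ) ς := by
  have hexp := QG.exp_add_eq_star_exp_sub_of_mem_symmetryPoints hς
  exact ⟨fun α => ⟨QG.spec_magneticOp_conj (hexp α), QG.multiplicity_magneticOp_conj (hexp α)⟩,
    fun n hn hsimple => QG.hasFDerivAt_zero_of_even
      (QG.differentiableAt_nthEigenvalue_magneticOp hn hsimple)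
      fun α => QG.nthEigenvalue_magneticOp_conj (hexp α) n⟩
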